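/- **Notation.** Let $\mathbb N=\{1,2,\dots\}$. For non-empty finite $s,t\subset\mathbb N$ write $s<t$ if $\max s<\min t$. Let $\mathcal B^{<\omega}(\mathbb N)$ be the set of finite disjoint collections $\mathbf s=\{s_1<\dots<s_k\}$ of non-empty finite subsets of $\mathbb N$, including $\emptyset$. An infinite disjoint collection is a sequence $\mathcal D=(s_1<s_2<\cdots)$ of such sets. $FU(\cdot)$ is the set of all unions of finitely many (at least one) members of a collection; $\mathcal D_1<\mathcal D$ means $\mathcal D_1\subseteq FU(\mathcal D)$; and $\mathcal B^{<\omega}(\mathcal D)=\{\mathbf s\in\mathcal B^{<\omega}(\mathbb N):\mathbf s\subseteq FU(\mathcal D)\}$. For each non-zero countable limit ordinal $\lambda$ fix any strictly increasing sequence $(\lambda_n)_{n\ge1}$ of successor ordinals below $\lambda$ with supremum $\lambda$. Define families $\mathcal A_\xi$ $(\xi<\omega_1)$ of finite subsets of $\mathbb N$ by: $\mathcal A_0=\{\emptyset\}$; $\mathcal A_{\zeta+1}=\{\{n\}\cup s: s\in\mathcal A_\zeta,\ n<\min s \text{ if } s\neq\emptyset\}$; $\mathcal A_{\omega^{\beta+1}}=\{s_1\cup\dots\cup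 s_n: s_1<\dots<s_n \text{ in } \mathcal A_{\omega^\beta},\ n=\min s_1\}$; $\mathcal A_{\omega^\lambda}=\{s: s\in\mathcal A_{\omega^{\lambda_n}},\ n=\min s\}$ for $\lambda$ a non-zero limit; and, for a limit $\xi=\omega^{b_1}+\dots+\omega^{b_r}$ with $r\ge2$ and $b_1\ge\dots\ge b_r>0$, $\mathcal A_\xi=\{s_1\cup\dots\cup s_r: s_r<\dots<s_1,\ s_i\in\mathcal A_{\omega^{b_i}}\}$. Let $\mathcal B^\xi$ be the set of $\{s_1<\dots<s_k\}\in\mathcal B^{<\omega}(\mathbb N)$ with $\{\min s_1,\dots,\min s_k\}\in\mathcal A_\xi$ (so $\mathcal B^0=\{\emptyset\}$). For $\mathcal F\subseteq\mathcal B^{<\omega}(\mathbb N)$ let $\mathcal F^*$ be the set of initial segments of members of $\mathcal F$ together with $\emptyset$. $\mathcal F$ is *hereditary* if $\mathcal F=\mathcal F_*:=\{\mathbf t\in\mathcal B^{<\omega}(\mathbb N):\mathbf t\subseteq FU(\mathbf s)\text{ for some }\mathbf s\in\mathcal F\}\cup\{\emptyset\}$. $\mathcal F$ is *pointwise closed*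 if its set of characteristic functions is closed in $\{0,1\}^{[\mathbb N]^{<\omega}}$, where $[\mathbb N]^{<\omega}$ is the set of finite subsets of $\mathbb N$. Put $(\mathcal F)^0_{\mathcal D}=\mathcal F$; let $(\mathcal F)^1_{\mathcal D}$ be the set of $\mathbf s\in\mathcal F\cap\mathcal B^{<\omega}(\mathcal D)$ such that $\{t\in FU(\mathcal D):\mathbf s\cup\{t\}\notin\mathcal F\}$ contains no infinite disjoint collection; let $(\mathcal F)^{\zeta+1}_{\mathcal D}=((\mathcal F)^\zeta_{\mathcal D})^1_{\mathcal D}$, with intersections at limits. Let $s_{\mathcal D}(\mathcal F)$ be the least $\xi$ with $(\mathcal F)^\xi_{\mathcal D}=\emptyset$. **Theorem 3.1.** Let $\mathcal F$ be a hereditary family of finite disjoint collections and $\mathcal D$ an infinite disjoint collection. *Case 1.* If $\mathcal F\cap\mathcal B^{<\omega}(\mathcal D)$ is not pointwise closed, then there is $\mathcal D_1<\mathcal D$ with $\mathcal B^{<\omega}(\mathcal D_1)\subseteq\mathcal F$. *Case 2.* If $\mathcal F\cap\mathcal B^{<\omega}(\mathcal D)$ is pointwise closed, then for every $\mathcal D_1<\mathcal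 D$ the index $s_{\mathcal D_1}(\mathcal F)$ exists and is countable, $\xi^{\mathcal F}_{\mathcal D}:=\sup\{s_{\mathcal D_1}(\mathcal F):\mathcal D_1<\mathcal D\}$ is a countable ordinal, and for every $\xi<\omega_1$: - 2(i) if $\xi+1<\xi^{\mathcal F}_{\mathcal D}$, there is $\mathcal D_2<\mathcal D$ with $\mathcal B^\xi\cap\mathcal B^{<\omega}(\mathcal D_2)\subseteq\mathcal F$; - 2(ii) if $\xi+1>\xi^{\mathcal F}_{\mathcal D}$, then for every $\mathcal D_1<\mathcal D$ there is $\mathcal D_2<\mathcal D_1$ with $\mathcal B^\xi\cap\mathcal B^{<\omega}(\mathcal D_2)\subseteq\mathcal B^{<\omega}(\mathbb N)\setminus\mathcal F$; moreover, for every $\mathcal D_2<\mathcal D_1$ this inclusion is equivalent to $\mathcal F\cap\mathcal B^{<\omega}(\mathcal D_2)\subseteq(\mathcal B^\xi)^*\setminus\mathcal B^\xi$; - 2(iii) if $\xi+1=\xi^{\mathcal F}_{\mathcal D}$, there is $\mathcal D_2<\mathcal D$ with either $\mathcal B^\xi\cap\mathcal B^{<\omega}(\mathcal D_2)\subseteq\mathcal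 F$ or $\mathcal B^\xi\cap\mathcal B^{<\omega}(\mathcal D_2)\subseteq\mathcal B^{<\omega}(\mathbb N)\setminus\mathcal F$. Both alternatives in 2(iii) may materialize, already for $\xi=\omega$: there are $\mathcal D$ and a hereditary $\mathcal F$ with $\mathcal F\cap\mathcal B^{<\omega}(\mathcal D)$ pointwise closed and $\xi^{\mathcal F}_{\mathcal D}=\omega+1$ such that $\mathcal B^\omega\cap\mathcal B^{<\omega}(\mathcal D_2)\subseteq\mathcal F$ for every $\mathcal D_2<\mathcal D$; and there are such $\mathcal D$ and $\mathcal F$ for which $\mathcal B^\omega\cap\mathcal B^{<\omega}(\mathcal D_2)\subseteq\mathcal B^{<\omega}(\mathbb N)\setminus\mathcal F$ for every $\mathcal D_2<\mathcal D$. -/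

import Mathlib

namespace BlockRamsey

/-- `s < t` for sets of positive integers: every element of `s` lies below every element of `t`
(for non-empty finite sets this is `max s < min t`; it holds trivially if one of them is empty). -/
def BlockLT (s t : Finset ℕ+) : Prop := ∀ a ∈ s, ∀ b ∈ t, a < b

/-- A choice, for every non-zero countable limit ordinal `l`, of a strictly increasing sequence
`(lam l n)`, `n = 1, 2, …`, of successor ordinals smaller than `l` with supremum `l`. -/
def IsLadderSystem (lam : Ordinal.{0} → ℕ+ → Ordinal.{0}) : Prop :=
  ∀ l : Ordinal.{0}, Order.IsSuccLimit l → l < Ordinal.omega 1 →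
    StrictMono (lam l) ∧ (∀ n, ∃ b, lam l n = b + 1) ∧ (∀ n, lam l n < l) ∧
      IsLUB (Set.range (lam l)) l

/-- `Schreier lam ξ s` says that `s` belongs to the family `𝒜_ξ` of the recursive thin Schreier
system built from the sequences `lam`. For a choice `lam` as above, every countable ordinal is the
index of exactly one of the five rules, and that rule refers to smaller ordinals only, so this is
the recursive definition. -/
inductive Schreier (lam : Ordinal.{0} → ℕ+ → Ordinal.{0}) : Ordinal.{0} → Finset ℕ+ → Prop
  /-- `𝒜_0 = {∅}`. -/
  | zero : Schreier lam 0 ∅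
  /-- `𝒜_{ζ+1}`: the sets `{n} ∪ s` with `{n} < s` and `s ∈ 𝒜_ζ`. -/
  | succ (ζ : Ordinal.{0}) (n : ℕ+) (s : Finset ℕ+) (hn : BlockLT {n} s)
      (hs : Schreier lam ζ s) : Schreier lam (ζ + 1) (insert n s)
  /-- `𝒜_{ω^(β+1)}`: the unions of `s_1 < ⋯ < s_n` in `𝒜_{ω^β}` with `n = min s_1`. -/
  | powSucc (β : Ordinal.{0}) (n : ℕ+) (s : Fin (n : ℕ) → Finset ℕ+)
      (hmin : IsLeast (s ⟨0, n.pos⟩ : Set ℕ+) n)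
      (hlt : ∀ i j, i < j → BlockLT (s i) (s j))
      (hs : ∀ i, Schreier lam (Ordinal.omega0 ^ β) (s i)) :
      Schreier lam (Ordinal.omega0 ^ (β + 1)) (Finset.univ.biUnion s)
  /-- `𝒜_{ω^l}`, `l` a non-zero limit: the sets `s ∈ 𝒜_{ω^(l_n)}` with `n = min s`. -/
  | powLimit (l : Ordinal.{0}) (hl : Order.IsSuccLimit l) (n : ℕ+) (s : Finset ℕ+)
      (hmin : IsLeast (s : Set ℕ+) n)
      (hs : Schreier lam (Ordinal.omega0 ^ (lam l n)) s) : Schreier lam (Ordinal.omega0 ^ l) s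
  /-- The limit ordinals that are not powers of `ω`. The Cantor normal form is written out with
  repetitions instead of coefficients, as `ω^(b_0) + ⋯ + ω^(b_(r-1))` with `r ≥ 2` and
  `b_0 ≥ ⋯ ≥ b_(r-1) > 0`; the members are the unions of sets `s_(r-1) < ⋯ < s_0` with
  `s_i ∈ 𝒜_{ω^(b_i)}`. -/
  | normalForm (r : ℕ) (hr : 2 ≤ r) (b : Fin r → Ordinal.{0}) (hb : Antitone b)
      (hpos : ∀ i, 0 < b i) (s : Fin r → Finset ℕ+)
      (hlt : ∀ i j, i < j → BlockLT (s j) (s i))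
      (hs : ∀ i, Schreier lam (Ordinal.omega0 ^ (b i)) (s i)) :
      Schreier lam (List.ofFn fun i => Ordinal.omega0 ^ (b i)).sum (Finset.univ.biUnion s)

/-- All unions of finitely many (at least one) members of a collection `C` of finite sets. -/
def FU (C : Set (Finset ℕ+)) : Set (Finset ℕ+) :=
  {u | ∃ J : Finset (Finset ℕ+), J.Nonempty ∧ (∀ v ∈ J, v ∈ C) ∧ u = J.biUnion id}

/-- `ℬ^{<ω}(ℕ)`: the finite disjoint collections `s_1 < ⋯ < s_k` of non-empty finite sets of
positive integers, including the empty one. -/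
def FinColl : Set (Finset (Finset ℕ+)) :=
  {s | (∀ u ∈ s, u.Nonempty) ∧ ∀ u ∈ s, ∀ v ∈ s, u ≠ v → BlockLT u v ∨ BlockLT v u}

/-- `ℬ^ω(ℕ)`: the infinite disjoint collections, as increasing sequences of non-empty finite
sets of positive integers. -/
structure InfColl where
  seq : ℕ → Finset ℕ+
  nonempty : ∀ n, (seq n).Nonempty
  lt_succ : ∀ n, BlockLT (seq n) (seq (n + 1))

/-- The collection as a set of finite sets. -/
def InfColl.blocks (D : InfColl) : Set (Finset ℕ+) := Set.range D.seq

/-- `D₁ < D`, that is, `D₁ ⊆ FU(D)`. -/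
def InfColl.Below (D₁ D : InfColl) : Prop := D₁.blocks ⊆ FU D.blocks

/-- `ℬ^{<ω}(D)`. -/
def FinCollOf (D : InfColl) : Set (Finset (Finset ℕ+)) :=
  {s | s ∈ FinColl ∧ ∀ u ∈ s, u ∈ FU D.blocks}

/-- The minimum of a non-empty finite set of positive integers (`1` for the empty set). -/
def blockMin (u : Finset ℕ+) : ℕ+ := if h : u.Nonempty then u.min' h else 1

/-- `ℬ^ξ`: the finite disjoint collections whose set of minima lies in `𝒜_ξ`. For `ξ = 0` this is
`{∅}`; for `ξ ≥ 1` the empty collection is not a member, because `∅ ∉ 𝒜_ξ`. -/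
def BlockSchreier (lam : Ordinal.{0} → ℕ+ → Ordinal.{0}) (ξ : Ordinal.{0}) :
    Set (Finset (Finset ℕ+)) :=
  {s | s ∈ FinColl ∧ Schreier lam ξ (s.image blockMin)}

/-- `s` is an initial segment of the finite disjoint collection `t`. -/
def IsInitialSeg (s t : Finset (Finset ℕ+)) : Prop :=
  s ⊆ t ∧ ∀ u ∈ t, ∀ v ∈ s, BlockLT u v → u ∈ s

/-- `𝓕^*`: all initial segments of members of `𝓕`, and the empty collection. -/
def initialClosure (F : Set (Finset (Finset ℕ+))) : Set (Finset (Finset ℕ+)) :=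
  {t | t ∈ FinColl ∧ ∃ s ∈ F, IsInitialSeg t s} ∪ {∅}

/-- `𝓕_*`: all finite disjoint collections `t ⊆ FU(s)` with `s ∈ 𝓕`, and the empty one. -/
def lowerClosure (F : Set (Finset (Finset ℕ+))) : Set (Finset (Finset ℕ+)) :=
  {t | t ∈ FinColl ∧ ∃ s ∈ F, ∀ u ∈ t, u ∈ FU (s : Set (Finset ℕ+))} ∪ {∅}

/-- `𝓕` is hereditary. -/
def IsHereditary (F : Set (Finset (Finset ℕ+))) : Prop := lowerClosure F = F

/-- The characteristic function of a finite collection. -/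
def charFn (s : Finset (Finset ℕ+)) : Finset ℕ+ → Bool := fun u => decide (u ∈ s)

/-- `𝓕` is pointwise closed: its characteristic functions form a closed subset of the product
of copies of the discrete space `{0,1}`, one for each finite set of positive integers. -/
def PointwiseClosed (F : Set (Finset (Finset ℕ+))) : Prop := IsClosed (charFn '' F)

/-- The first strong block Cantor-Bendixson derivative of `𝓕` on `D`: those `s` in
`𝓕 ∩ ℬ^{<ω}(D)` for which `{t ∈ FU(D) : s ∪ {t} ∉ 𝓕}` contains no infinite disjoint collection. -/
def strongDeriv (D : InfColl) (F : Set (Finset (Finset ℕ+))) : Set (Finset (Finset ℕ+)) :=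
  {s | s ∈ F ∩ FinCollOf D ∧
    ¬ ∃ E : InfColl, E.blocks ⊆ {t | t ∈ FU D.blocks ∧ insert t s ∉ F}}

/-- The iterated derivatives, with intersections at limit ordinals. -/
noncomputable def iterDeriv (D : InfColl) (F : Set (Finset (Finset ℕ+))) (ξ : Ordinal.{0}) :
    Set (Finset (Finset ℕ+)) :=
  Ordinal.limitRecOn ξ F (fun _ G => strongDeriv D G) (fun ζ _ G => ⋂ β, ⋂ h : β < ζ, G β h)

/-- The strong block Cantor-Bendixson index `s_D(𝓕)`: the least `ξ` whose derivative is empty. -/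
noncomputable def strongIndex (D : InfColl) (F : Set (Finset (Finset ℕ+))) : Ordinal.{0} :=
  sInf {ξ | iterDeriv D F ξ = ∅}

/-- `ξ_D^𝓕`: the supremum of `s_{D₁}(𝓕)` over all `D₁ < D`. -/
noncomputable def supIndex (D : InfColl) (F : Set (Finset (Finset ℕ+))) : Ordinal.{0} :=
  sSup {η | ∃ D₁ : InfColl, D₁.Below D ∧ η = strongIndex D₁ F}

end BlockRamsey

/-! The theorem compares two ranks on trees of finite disjoint collections: the order to which the
derivative of `F` can be iterated before losing `∅`, and the rank `ξ` of `BlockSchreier lam ξ`.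

If `F` is not closed on `D`, a limit point outside `F` has infinite support all of whose finite
parts lie in `F`. The support contains an infinite disjoint collection, and heredity puts every
finite collection of its unions into `F`. If `F` is closed on `D`, no infinite collection below `D`
has all its finite parts in `F`. A collection whose ranks on the various `D₁` had no common
countable bound would have a one-block end-extension of the same kind, there being only countably
many blocks. Iterating would give such an infinite collection, so one countable ordinal bounds all
indices (`PointwiseClosed.exists_countable_bound`).

For the dichotomy, `blockRank_blockSchreier` shows that the tree of `BlockSchreier lam ξ` has rank
exactly `ξ`, and `BlockRank.ramsey`, obtained from an idempotent ultrafilter for unions, makes such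
a front homogeneous for `F` on a smaller collection. If `∅` survives `ξ + 1` derivations, the front
meets `F` (`BlockRank.exists_mem_of_mem_iterDeriv`). If the front lies in `F`, then `∅` survives `ξ`
derivations (`BlockRank.mem_iterDeriv`). Each of these excludes one homogeneous alternative, and the
gap of one between them is the undecided case. In that case both alternatives occur, for the
families of collections whose cardinality is at most, or less than, every integer occurring in them.
-/

namespace BlockRamsey

/-! ### Blocks, finite unions and disjoint collections -/

/-- The block `t` lies beyond all members of `s`. -/
def Beyond (s : Finset (Finset ℕ+)) (t : Finset ℕ+) : Prop := ∀ u ∈ s, BlockLT u t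

/-- All elements of `t` are larger than `N`. -/
def Above (N : ℕ) (t : Finset ℕ+) : Prop := ∀ x ∈ t, N < (x : ℕ)

theorem BlockLT.trans {s t u : Finset ℕ+} (ht : t.Nonempty) (h₁ : BlockLT s t)
    (h₂ : BlockLT t u) : BlockLT s u := by
  obtain ⟨b, hb⟩ := ht
  exact fun a ha c hc => (h₁ a ha b hb).trans (h₂ b hb c hc)

theorem BlockLT.mono {s t s' t' : Finset ℕ+} (h : BlockLT s t) (hs : s' ⊆ s) (ht : t' ⊆ t) :
    BlockLT s' t' := fun a ha b hb => h a (hs ha) b (ht hb)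

theorem BlockLT.not_symm {s t : Finset ℕ+} (hs : s.Nonempty) (ht : t.Nonempty)
    (h : BlockLT s t) : ¬ BlockLT t s := by
  obtain ⟨a, ha⟩ := hs
  obtain ⟨b, hb⟩ := ht
  exact fun h' => (h a ha b hb).asymm (h' b hb a ha)

theorem BlockLT.ne {s t : Finset ℕ+} (hs : s.Nonempty) (h : BlockLT s t) : s ≠ t := by
  rintro rfl
  exact h.not_symm hs hs h

theorem Beyond.notMem {s : Finset (Finset ℕ+)} {t : Finset ℕ+} (ht : t.Nonempty)
    (h : Beyond s t) : t ∉ s := fun hts => (h t hts).ne ht rfl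

theorem Beyond.insert {s : Finset (Finset ℕ+)} {t u : Finset ℕ+} (h : Beyond s u)
    (htu : BlockLT t u) : Beyond (insert t s) u := by
  intro v hv
  rcases Finset.mem_insert.1 hv with rfl | hv
  exacts [htu, h v hv]

theorem Above.mono {M N : ℕ} {t : Finset ℕ+} (h : Above N t) (hMN : M ≤ N) : Above M t :=
  fun x hx => lt_of_le_of_lt hMN (h x hx)

theorem exists_bound (s : Finset (Finset ℕ+)) : ∃ N : ℕ, ∀ u ∈ s, ∀ x ∈ u, (x : ℕ) ≤ N :=
  ⟨(s.biUnion id).sup (fun x => (x : ℕ)), fun u hu x hx =>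
    Finset.le_sup (f := fun x : ℕ+ => (x : ℕ)) (Finset.mem_biUnion.2 ⟨u, hu, hx⟩)⟩

theorem Above.beyond {N : ℕ} {s : Finset (Finset ℕ+)} {t : Finset ℕ+} (ht : Above N t)
    (hs : ∀ u ∈ s, ∀ x ∈ u, (x : ℕ) ≤ N) : Beyond s t := fun u hu x hx y hy =>
  (PNat.coe_lt_coe x y).1 (lt_of_le_of_lt (hs u hu x hx) (ht y hy))

theorem blockMin_mem {u : Finset ℕ+} (h : u.Nonempty) : blockMin u ∈ u := by
  rw [blockMin, dif_pos h]
  exact u.min'_mem h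

theorem blockMin_le {u : Finset ℕ+} {x : ℕ+} (hx : x ∈ u) : blockMin u ≤ x := by
  rw [blockMin, dif_pos ⟨x, hx⟩]
  exact u.min'_le x hx

theorem BlockLT.blockMin_lt {s t : Finset ℕ+} (hs : s.Nonempty) (ht : t.Nonempty)
    (h : BlockLT s t) : blockMin s < blockMin t := h _ (blockMin_mem hs) _ (blockMin_mem ht)

theorem above_iff_blockMin {N : ℕ} {t : Finset ℕ+} (ht : t.Nonempty) :
    Above N t ↔ N < (blockMin t : ℕ) :=
  ⟨fun h => h _ (blockMin_mem ht), fun h _ hx => lt_of_lt_of_le h (blockMin_le hx)⟩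

theorem mem_FU_of_mem {C : Set (Finset ℕ+)} {u : Finset ℕ+} (h : u ∈ C) : u ∈ FU C :=
  ⟨{u}, by simp, by simpa using h, by simp⟩

theorem union_mem_FU {C : Set (Finset ℕ+)} {u v : Finset ℕ+} (hu : u ∈ FU C) (hv : v ∈ FU C) :
    u ∪ v ∈ FU C := by
  obtain ⟨J, hJ, hJC, rfl⟩ := hu
  obtain ⟨K, -, hKC, rfl⟩ := hv
  refine ⟨J ∪ K, hJ.mono Finset.subset_union_left, fun v hv => ?_, ?_⟩
  · rcases Finset.mem_union.1 hv with h | h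
    exacts [hJC v h, hKC v h]
  · rw [Finset.union_biUnion]

theorem FU_subset_of_union_closed {C X : Set (Finset ℕ+)} (hC : C ⊆ X)
    (hX : ∀ u ∈ X, ∀ v ∈ X, u ∪ v ∈ X) : FU C ⊆ X := by
  rintro _ ⟨J, hJ, hJC, rfl⟩
  induction hJ using Finset.Nonempty.cons_induction with
  | singleton a => simpa using hC (hJC a (by simp))
  | cons a s ha hs ih =>
    rw [Finset.cons_eq_insert, Finset.biUnion_insert]
    exact hX _ (hC (hJC a (by simp))) _ (ih fun v hv => hJC v (by simp [hv]))

theorem FU_subset_FU {C C' : Set (Finset ℕ+)} (h : C ⊆ FU C') : FU C ⊆ FU C' :=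
  FU_subset_of_union_closed h fun _ hu _ hv => union_mem_FU hu hv

theorem FU_mono {C C' : Set (Finset ℕ+)} (h : C ⊆ C') : FU C ⊆ FU C' :=
  FU_subset_FU fun _ hu => mem_FU_of_mem (h hu)

theorem nonempty_of_mem_FU {C : Set (Finset ℕ+)} (hC : ∀ v ∈ C, v.Nonempty) {u : Finset ℕ+}
    (hu : u ∈ FU C) : u.Nonempty :=
  FU_subset_of_union_closed (X := {u | u.Nonempty}) hC
    (fun _ hu _ _ => hu.mono Finset.subset_union_left) hu

theorem InfColl.nonempty_of_mem_FU {D : InfColl} {u : Finset ℕ+} (hu : u ∈ FU D.blocks) :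
    u.Nonempty :=
  BlockRamsey.nonempty_of_mem_FU (by rintro _ ⟨n, rfl⟩; exact D.nonempty n) hu

theorem InfColl.lt (D : InfColl) {i j : ℕ} (hij : i < j) : BlockLT (D.seq i) (D.seq j) := by
  induction j, hij using Nat.le_induction with
  | base => exact D.lt_succ i
  | succ j _ ih => exact ih.trans (D.nonempty j) (D.lt_succ j)

theorem InfColl.above (D : InfColl) (n : ℕ) : Above n (D.seq n) := by
  induction n with
  | zero => exact fun x _ => x.pos
  | succ n ih =>
    intro x hx
    obtain ⟨y, hy⟩ := D.nonempty n
    exact lt_of_le_of_lt (ih y hy) (PNat.coe_lt_coe y x |>.2 (D.lt_succ n y hy x hx))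

theorem InfColl.mem_FU_iff {D : InfColl} {u : Finset ℕ+} :
    u ∈ FU D.blocks ↔ ∃ I : Finset ℕ, I.Nonempty ∧ u = I.biUnion D.seq := by
  constructor
  · refine fun hu => FU_subset_of_union_closed
      (X := {u | ∃ I : Finset ℕ, I.Nonempty ∧ u = I.biUnion D.seq}) ?_ ?_ hu
    · rintro _ ⟨n, rfl⟩
      exact ⟨{n}, by simp, by simp⟩
    · rintro _ ⟨I, hI, rfl⟩ _ ⟨J, -, rfl⟩
      exact ⟨I ∪ J, hI.mono Finset.subset_union_left, by rw [Finset.union_biUnion]⟩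
  · rintro ⟨I, hI, rfl⟩
    induction hI using Finset.Nonempty.cons_induction with
    | singleton a => simpa using mem_FU_of_mem (C := D.blocks) ⟨a, rfl⟩
    | cons a s ha hs ih =>
      rw [Finset.cons_eq_insert, Finset.biUnion_insert]
      exact union_mem_FU (mem_FU_of_mem ⟨a, rfl⟩) ih

theorem InfColl.exists_above (D : InfColl) (N : ℕ) : ∃ t ∈ FU D.blocks, Above N t :=
  ⟨_, mem_FU_of_mem ⟨N, rfl⟩, D.above N⟩

theorem InfColl.Below.refl (D : InfColl) : D.Below D := fun _ hu => mem_FU_of_mem hu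

theorem InfColl.Below.trans {D₁ D₂ D₃ : InfColl} (h₁ : D₁.Below D₂) (h₂ : D₂.Below D₃) :
    D₁.Below D₃ := fun _ hu => FU_subset_FU h₂ (h₁ hu)

theorem empty_mem_FinColl : ∅ ∈ FinColl := by simp [FinColl]

theorem empty_mem_FinCollOf (D : InfColl) : ∅ ∈ FinCollOf D := ⟨empty_mem_FinColl, by simp⟩

theorem FinColl_subset {s t : Finset (Finset ℕ+)} (ht : t ∈ FinColl) (h : s ⊆ t) :
    s ∈ FinColl :=
  ⟨fun u hu => ht.1 u (h hu), fun u hu v hv => ht.2 u (h hu) v (h hv)⟩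

theorem FinCollOf_subset {D : InfColl} {s t : Finset (Finset ℕ+)} (ht : t ∈ FinCollOf D)
    (h : s ⊆ t) : s ∈ FinCollOf D := ⟨FinColl_subset ht.1 h, fun u hu => ht.2 u (h hu)⟩

theorem insert_mem_FinColl {s : Finset (Finset ℕ+)} {t : Finset ℕ+} (hs : s ∈ FinColl)
    (ht : t.Nonempty) (h : Beyond s t) : insert t s ∈ FinColl := by
  refine ⟨fun u hu => ?_, fun u hu v hv huv => ?_⟩
  · rcases Finset.mem_insert.1 hu with rfl | hu
    exacts [ht, hs.1 u hu]
  · rcases Finset.mem_insert.1 hu with hut | hus <;>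
      rcases Finset.mem_insert.1 hv with hvt | hvs
    · exact absurd (hut.trans hvt.symm) huv
    · exact Or.inr (hut ▸ h v hvs)
    · exact Or.inl (hvt ▸ h u hus)
    · exact hs.2 u hus v hvs huv

theorem insert_mem_FinCollOf {D : InfColl} {s : Finset (Finset ℕ+)} {t : Finset ℕ+}
    (hs : s ∈ FinCollOf D) (ht : t ∈ FU D.blocks) (h : Beyond s t) : insert t s ∈ FinCollOf D := by
  refine ⟨insert_mem_FinColl hs.1 (InfColl.nonempty_of_mem_FU ht) h, fun u hu => ?_⟩
  rcases Finset.mem_insert.1 hu with rfl | hu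
  exacts [ht, hs.2 u hu]

theorem BlockLT_of_blockMin_lt {s : Finset (Finset ℕ+)} (hs : s ∈ FinColl) {u v : Finset ℕ+}
    (hu : u ∈ s) (hv : v ∈ s) (huv : u ≠ v) (h : blockMin u ≤ blockMin v) : BlockLT u v :=
  (hs.2 u hu v hv huv).resolve_right fun h' =>
    absurd (h'.blockMin_lt (hs.1 v hv) (hs.1 u hu)) h.not_gt

theorem exists_last {s : Finset (Finset ℕ+)} (hs : s ∈ FinColl) (hne : s.Nonempty) :
    ∃ t s', s = insert t s' ∧ t.Nonempty ∧ Beyond s' t := by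
  obtain ⟨t, ht, hmax⟩ := s.exists_max_image blockMin hne
  refine ⟨t, s.erase t, (Finset.insert_erase ht).symm, hs.1 t ht, fun u hu => ?_⟩
  obtain ⟨hut, hu⟩ := Finset.mem_erase.1 hu
  exact BlockLT_of_blockMin_lt hs hu ht hut (hmax u hu)

theorem exists_first {s : Finset (Finset ℕ+)} (hs : s ∈ FinColl) (hne : s.Nonempty) :
    ∃ t s', s = insert t s' ∧ t.Nonempty ∧ ∀ u ∈ s', BlockLT t u := by
  obtain ⟨t, ht, hmin⟩ := s.exists_min_image blockMin hne
  refine ⟨t, s.erase t, (Finset.insert_erase ht).symm, hs.1 t ht, fun u hu => ?_⟩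
  obtain ⟨hut, hu⟩ := Finset.mem_erase.1 hu
  exact BlockLT_of_blockMin_lt hs ht hu hut.symm (hmin u hu)

/-- Induction on the blocks of a finite disjoint collection, adding the last block. -/
theorem FinColl.induction {p : Finset (Finset ℕ+) → Prop} (empty : p ∅)
    (step : ∀ t s, s ∈ FinColl → t.Nonempty → Beyond s t → p s → p (insert t s))
    {s : Finset (Finset ℕ+)} (hs : s ∈ FinColl) : p s := by
  induction hn : s.card generalizing s with
  | zero => rwa [Finset.card_eq_zero.1 hn]
  | succ n ih =>
    obtain ⟨t, s', rfl, ht, hb⟩ := exists_last hs (Finset.card_pos.1 (by omega))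
    have hs' := FinColl_subset hs (Finset.subset_insert t s')
    rw [Finset.card_insert_of_notMem (hb.notMem ht)] at hn
    exact step t s' hs' ht hb (ih hs' (by omega))

/-! ### Hereditary families and their derivatives -/

/-- The family is closed under passing to collections of unions of members. -/
def IsDownClosed (F : Set (Finset (Finset ℕ+))) : Prop :=
  ∀ s ∈ F, ∀ t ∈ FinColl, (∀ u ∈ t, u ∈ FU (s : Set (Finset ℕ+))) → t ∈ F

theorem IsHereditary.isDownClosed {F : Set (Finset (Finset ℕ+))} (h : IsHereditary F) :
    IsDownClosed F := fun s hs t ht hts => h ▸ Or.inl ⟨ht, s, hs, hts⟩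

theorem IsHereditary.empty_mem {F : Set (Finset (Finset ℕ+))} (h : IsHereditary F) : ∅ ∈ F :=
  h ▸ Or.inr rfl

theorem IsDownClosed.isHereditary {F : Set (Finset (Finset ℕ+))} (h : IsDownClosed F)
    (h₀ : ∅ ∈ F) (hF : F ⊆ FinColl) : IsHereditary F := by
  refine Set.Subset.antisymm ?_ fun s hs => Or.inl ⟨hF hs, s, hs, fun u hu => mem_FU_of_mem hu⟩
  rintro t (⟨ht, s, hs, hts⟩ | rfl)
  exacts [h s hs t ht hts, h₀]

theorem IsDownClosed.subset_mem {F : Set (Finset (Finset ℕ+))} (h : IsDownClosed F)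
    {s t : Finset (Finset ℕ+)} (ht : t ∈ F) (htF : t ∈ FinColl) (hst : s ⊆ t) : s ∈ F :=
  h t ht s (FinColl_subset htF hst) fun u hu => mem_FU_of_mem (hst hu)

theorem IsDownClosed.empty_mem {F : Set (Finset (Finset ℕ+))} (h : IsDownClosed F)
    (hne : F.Nonempty) : ∅ ∈ F := by
  obtain ⟨s, hs⟩ := hne
  exact h s hs ∅ empty_mem_FinColl (by simp)

theorem exists_infColl {A : Set (Finset ℕ+)} (h : ∀ N, ∃ t ∈ A, t.Nonempty ∧ Above N t) :
    ∃ E : InfColl, E.blocks ⊆ A := by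
  choose f hfA hfne hf using h
  let g : ℕ → Finset ℕ+ := fun n => Nat.rec (f 0) (fun _ u => f (exists_bound {u}).choose) n
  have hg : ∀ n, g (n + 1) = f (exists_bound {g n}).choose := fun n => rfl
  have hmem : ∀ n, ∃ N, g n = f N := fun n => by
    cases n with
    | zero => exact ⟨0, rfl⟩
    | succ n => exact ⟨_, hg n⟩
  refine ⟨⟨g, fun n => ?_, fun n => ?_⟩, ?_⟩
  · obtain ⟨N, hN⟩ := hmem n
    exact hN ▸ hfne N
  · rw [hg]
    exact (hf _).beyond (exists_bound {g n}).choose_spec (g n) (by simp)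
  · rintro _ ⟨n, rfl⟩
    obtain ⟨N, hN⟩ := hmem n
    exact (congrArg (· ∈ A) hN).mpr (hfA N)

/-- A set containing no infinite disjoint collection cannot have blocks arbitrarily far out, since a
greedy choice would produce such a collection. Later arguments use the derivative only in this
eventual form. -/
theorem mem_strongDeriv_iff {D : InfColl} {F : Set (Finset (Finset ℕ+))}
    {s : Finset (Finset ℕ+)} :
    s ∈ strongDeriv D F ↔ s ∈ F ∧ s ∈ FinCollOf D ∧
      ∃ N, ∀ t ∈ FU D.blocks, Above N t → insert t s ∈ F := by
  constructor
  · rintro ⟨⟨hF, hD⟩, h⟩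
    refine ⟨hF, hD, ?_⟩
    by_contra! hN
    refine h (exists_infColl fun N => ?_)
    obtain ⟨t, ht, htN, hts⟩ := hN N
    exact ⟨t, ⟨ht, hts⟩, InfColl.nonempty_of_mem_FU ht, htN⟩
  · rintro ⟨hF, hD, N, hN⟩
    refine ⟨⟨hF, hD⟩, ?_⟩
    rintro ⟨E, hE⟩
    obtain ⟨ht, hts⟩ := hE ⟨N, rfl⟩
    exact hts (hN _ ht (E.above N))

theorem strongDeriv_subset (D : InfColl) (F : Set (Finset (Finset ℕ+))) :
    strongDeriv D F ⊆ F := fun _ hs => hs.1.1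

theorem exists_insert_mem_of_mem_strongDeriv {D : InfColl} {F : Set (Finset (Finset ℕ+))}
    {s : Finset (Finset ℕ+)} (hs : s ∈ strongDeriv D F) :
    ∃ t ∈ FU D.blocks, Beyond s t ∧ insert t s ∈ F := by
  obtain ⟨-, -, N, hN⟩ := mem_strongDeriv_iff.1 hs
  obtain ⟨M, hM⟩ := exists_bound s
  obtain ⟨t, ht, hta⟩ := D.exists_above (max M N)
  exact ⟨t, ht, (hta.mono (le_max_left _ _)).beyond hM, hN t ht (hta.mono (le_max_right _ _))⟩

theorem bound_of_mem_FU {s : Finset (Finset ℕ+)} {M : ℕ} (hM : ∀ u ∈ s, ∀ x ∈ u, (x : ℕ) ≤ M)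
    {u : Finset ℕ+} (hu : u ∈ FU (s : Set (Finset ℕ+))) : ∀ x ∈ u, (x : ℕ) ≤ M :=
  FU_subset_of_union_closed (X := {u | ∀ x ∈ u, (x : ℕ) ≤ M}) (fun v hv => hM v hv)
    (fun u hu v hv x hx => (Finset.mem_union.1 hx).elim (hu x) (hv x)) hu

theorem IsDownClosed.strongDeriv {F : Set (Finset (Finset ℕ+))} (h : IsDownClosed F)
    (D : InfColl) : IsDownClosed (strongDeriv D F) := by
  intro s hs t ht hts
  obtain ⟨hF, hD, N, hN⟩ := mem_strongDeriv_iff.1 hs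
  have htD : t ∈ FinCollOf D := ⟨ht, fun u hu => FU_subset_FU hD.2 (hts u hu)⟩
  obtain ⟨M, hM⟩ := exists_bound s
  refine mem_strongDeriv_iff.2 ⟨h s hF t ht hts, htD, max M N, fun v hv hvN => ?_⟩
  refine h _ (hN v hv (hvN.mono (le_max_right _ _))) _ ?_ fun u hu => ?_
  · exact insert_mem_FinColl ht (InfColl.nonempty_of_mem_FU hv)
      ((hvN.mono (le_max_left _ _)).beyond fun u hu => bound_of_mem_FU hM (hts u hu))
  · rcases Finset.mem_insert.1 hu with rfl | hu
    · exact mem_FU_of_mem (by simp)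
    · exact FU_mono (by simp) (hts u hu)

theorem iterDeriv_zero (D : InfColl) (F : Set (Finset (Finset ℕ+))) : iterDeriv D F 0 = F :=
  Ordinal.limitRecOn_zero ..

theorem iterDeriv_add_one (D : InfColl) (F : Set (Finset (Finset ℕ+))) (ξ : Ordinal.{0}) :
    iterDeriv D F (ξ + 1) = strongDeriv D (iterDeriv D F ξ) :=
  Ordinal.limitRecOn_add_one ..

theorem mem_iterDeriv_limit {D : InfColl} {F : Set (Finset (Finset ℕ+))} {ξ : Ordinal.{0}}
    (hξ : Order.IsSuccLimit ξ) {s : Finset (Finset ℕ+)} :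
    s ∈ iterDeriv D F ξ ↔ ∀ β < ξ, s ∈ iterDeriv D F β := by
  rw [iterDeriv, Ordinal.limitRecOn_limit _ _ _ _ hξ]
  simp [iterDeriv]

theorem iterDeriv_antitone (D : InfColl) (F : Set (Finset (Finset ℕ+))) :
    Antitone (iterDeriv D F) := by
  intro ζ ξ h
  induction ξ using Ordinal.limitRecOn with
  | zero => rw [nonpos_iff_eq_zero.1 h]
  | add_one ξ ih =>
    rcases h.eq_or_lt with rfl | h
    · exact le_rfl
    · rw [iterDeriv_add_one]
      exact (strongDeriv_subset _ _).trans (ih (Order.lt_add_one_iff.1 h))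
  | limit ξ hξ ih =>
    rcases h.eq_or_lt with rfl | h
    · exact le_rfl
    · exact fun s hs => (mem_iterDeriv_limit hξ).1 hs ζ h

theorem iterDeriv_subset (D : InfColl) (F : Set (Finset (Finset ℕ+))) (ξ : Ordinal.{0}) :
    iterDeriv D F ξ ⊆ F := by
  simpa [iterDeriv_zero] using iterDeriv_antitone D F (zero_le (a := ξ))

theorem IsDownClosed.iterDeriv {F : Set (Finset (Finset ℕ+))} (h : IsDownClosed F)
    (D : InfColl) (ξ : Ordinal.{0}) : IsDownClosed (iterDeriv D F ξ) := by
  induction ξ using Ordinal.limitRecOn with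
  | zero => rwa [iterDeriv_zero]
  | add_one ξ ih =>
    rw [iterDeriv_add_one]
    exact ih.strongDeriv D
  | limit ξ hξ ih =>
    intro s hs t ht hts
    rw [mem_iterDeriv_limit hξ] at hs ⊢
    exact fun β hβ => ih β hβ s (hs β hβ) t ht hts

/-- Treats all kinds of ordinals at once; `h₀` matters only for `ξ = 0`. -/
theorem mem_iterDeriv_of_forall_lt {D : InfColl} {F : Set (Finset (Finset ℕ+))}
    {ξ : Ordinal.{0}} {s : Finset (Finset ℕ+)} (h₀ : s ∈ F)
    (h : ∀ η < ξ, s ∈ iterDeriv D F (η + 1)) : s ∈ iterDeriv D F ξ := by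
  induction ξ using Ordinal.limitRecOn with
  | zero => rwa [iterDeriv_zero]
  | add_one ξ _ => exact h ξ (Order.lt_add_one_iff.2 le_rfl)
  | limit ξ hξ _ =>
    exact (mem_iterDeriv_limit hξ).2 fun β hβ =>
      iterDeriv_antitone D F (Order.le_succ β) (h β hβ)

/-- A smaller collection tests fewer blocks, so what lives on it survives at least as long. This
keeps `∅` in the derivatives when the Ramsey theorem shrinks the collection. -/
theorem iterDeriv_mono_below {D₁ D₂ : InfColl} (h : D₁.Below D₂) (F : Set (Finset (Finset ℕ+)))
    (ξ : Ordinal.{0}) : iterDeriv D₂ F ξ ∩ FinCollOf D₁ ⊆ iterDeriv D₁ F ξ := by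
  induction ξ using Ordinal.limitRecOn with
  | zero => simp [iterDeriv_zero]
  | add_one ξ ih =>
    rintro s ⟨hs, hs₁⟩
    rw [iterDeriv_add_one, mem_strongDeriv_iff] at hs ⊢
    obtain ⟨hF, hD, N, hN⟩ := hs
    obtain ⟨M, hM⟩ := exists_bound s
    refine ⟨ih ⟨hF, hs₁⟩, hs₁, max M N, fun t ht hta => ih ⟨?_, ?_⟩⟩
    · exact hN t (FU_subset_FU h ht) (hta.mono (le_max_right _ _))
    · exact insert_mem_FinCollOf hs₁ ht ((hta.mono (le_max_left _ _)).beyond hM)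
  | limit ξ hξ ih =>
    rintro s ⟨hs, hs₁⟩
    rw [mem_iterDeriv_limit hξ] at hs ⊢
    exact fun β hβ => ih β hβ ⟨hs β hβ, hs₁⟩

/-! ### An idempotent ultrafilter and the diagonal form of Hindman's theorem -/

/-- The ultrafilters concentrating on every tail of `FU D.blocks` form a non-empty compact
subsemigroup for the operation induced by union, and such a semigroup contains an idempotent. -/
theorem exists_union_idempotent (D : InfColl) : ∃ U : Ultrafilter (Finset ℕ+),
    (∀ N, ∀ᶠ t in (U : Filter (Finset ℕ+)), t ∈ FU D.blocks ∧ Above N t) ∧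
    ∀ p : Finset ℕ+ → Prop, (∀ᶠ t in (U : Filter (Finset ℕ+)), p t) →
      ∀ᶠ t in (U : Filter (Finset ℕ+)), ∀ᶠ u in (U : Filter (Finset ℕ+)), p (t ∪ u) := by
  let : Semigroup (Finset ℕ+) := { mul := (· ∪ ·), mul_assoc := Finset.union_assoc }
  let : Semigroup (Ultrafilter (Finset ℕ+)) := Ultrafilter.semigroup
  let X : ℕ → Set (Finset ℕ+) := fun N => {t | t ∈ FU D.blocks ∧ Above N t}
  have hX : ∀ N, ∀ t ∈ X N, ∀ u ∈ X N, t ∪ u ∈ X N := fun N t ht u hu =>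
    ⟨union_mem_FU ht.1 hu.1, fun x hx => (Finset.mem_union.1 hx).elim (ht.2 x) (hu.2 x)⟩
  let S : Set (Ultrafilter (Finset ℕ+)) := ⋂ N, {U | ∀ᶠ t in (U : Filter (Finset ℕ+)), t ∈ X N}
  have hne : S.Nonempty := by
    have := IsCompact.nonempty_iInter_of_directed_nonempty_isCompact_isClosed
      (fun N => {U : Ultrafilter (Finset ℕ+) | ∀ᶠ t in (U : Filter (Finset ℕ+)), t ∈ X N})
      (directed_of_isDirected_le fun M N hMN U hU =>
        Filter.Eventually.mono hU fun t ht => ⟨ht.1, ht.2.mono hMN⟩)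
      (fun N => ?_) (fun N => (ultrafilter_isClosed_basic _).isCompact)
      (fun N => ultrafilter_isClosed_basic _)
    · exact this
    · obtain ⟨t, ht⟩ := D.exists_above N
      exact ⟨pure t, ht⟩
  have hcompact : IsCompact S := by
    exact (isClosed_iInter fun N => ultrafilter_isClosed_basic _).isCompact
  have hmul : ∀ U ∈ S, ∀ V ∈ S, U * V ∈ S := by
    intro U hU V hV
    rw [Set.mem_iInter] at hU hV ⊢
    intro N
    refine (Ultrafilter.eventually_mul U V _).2 ?_
    filter_upwards [hU N] with t ht
    filter_upwards [hV N] with u hu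
    exact hX N t ht u hu
  obtain ⟨U, hU, hUU⟩ := exists_idempotent_in_compact_subsemigroup
    Ultrafilter.continuous_mul_left S hne hcompact hmul
  refine ⟨U, fun N => Set.mem_iInter.1 hU N, fun p hp => ?_⟩
  have := (Ultrafilter.eventually_mul U U p).1 (by rw [hUU]; exact hp)
  exact this

/-- The Galvin–Glazer construction of a collection with all its unions in a large set, combined with
diagonalization: once `d` is chosen, only finitely many collections live below its maximum, so the
sets `W s` for all of these can be imposed on the later choices. -/
theorem exists_diagonal_collection (D : InfColl) (U : Ultrafilter (Finset ℕ+))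
    (hU : ∀ N, ∀ᶠ t in (U : Filter (Finset ℕ+)), t ∈ FU D.blocks ∧ Above N t)
    (hUU : ∀ p : Finset ℕ+ → Prop, (∀ᶠ t in (U : Filter (Finset ℕ+)), p t) →
      ∀ᶠ t in (U : Filter (Finset ℕ+)), ∀ᶠ u in (U : Filter (Finset ℕ+)), p (t ∪ u))
    (W : Finset (Finset ℕ+) → Set (Finset ℕ+)) (hW : ∀ s, W s ∈ U) :
    ∃ D₁ : InfColl, D₁.Below D ∧ ∀ s ∈ FinCollOf D₁, ∀ t ∈ FU D₁.blocks, Beyond s t → t ∈ W s := by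
  have hpick : ∀ V : {V : Set (Finset ℕ+) // V ∈ U},
      ∃ d ∈ V.1, ∀ᶠ y in (U : Filter (Finset ℕ+)), d ∪ y ∈ V.1 := by
    intro V
    have h : ∀ᶠ y in (U : Filter (Finset ℕ+)), y ∈ V.1 := V.2
    obtain ⟨d, hd⟩ := (h.and (hUU _ h)).exists
    exact ⟨d, hd⟩
  have hfar : ∀ d : Finset ℕ+, ∀ᶠ y in (U : Filter (Finset ℕ+)), BlockLT d y := by
    intro d
    obtain ⟨N, hN⟩ := exists_bound {d}
    filter_upwards [hU N] with y hy
    exact hy.2.beyond hN d (by simp)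
  choose d hdV hd using hpick
  -- The union of the intervals is `[1, max e]`, so the double power set contains every collection
  -- built from `e` and earlier blocks.
  let R : Finset ℕ+ → Set (Finset ℕ+) := fun e =>
    ⋂ s ∈ (e.biUnion Finset.Iic).powerset.powerset, W s
  have hR : ∀ e, R e ∈ (U : Filter (Finset ℕ+)) := fun e =>
    (Filter.biInter_finset_mem _).2 fun s _ => hW s
  let next : {V : Set (Finset ℕ+) // V ∈ U} → {V : Set (Finset ℕ+) // V ∈ U} := fun V =>
    ⟨(V.1 ∩ {y | d V ∪ y ∈ V.1}) ∩ ({y | BlockLT (d V) y} ∩ R (d V)),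
      Filter.inter_mem (Filter.inter_mem V.2 (hd V)) (Filter.inter_mem (hfar _) (hR _))⟩
  let V₀ : {V : Set (Finset ℕ+) // V ∈ U} :=
    ⟨W ∅ ∩ {t | t ∈ FU D.blocks ∧ Above 0 t}, Filter.inter_mem (hW ∅) (hU 0)⟩
  let V : ℕ → {V : Set (Finset ℕ+) // V ∈ U} := fun n => Nat.rec V₀ (fun _ V => next V) n
  have hV : ∀ n, V (n + 1) = next (V n) := fun n => rfl
  have hanti : Antitone fun n => (V n).1 := antitone_nat_of_succ_le fun n y hy => by
    rw [hV] at hy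
    exact hy.1.1
  have hVD : ∀ n, (V n).1 ⊆ FU D.blocks := fun n y hy => (hanti (Nat.zero_le n) hy).2.1
  let D₁ : InfColl := ⟨fun n => d (V n),
    fun n => InfColl.nonempty_of_mem_FU (hVD n (hdV _)), fun n => by
      have h := hdV (V (n + 1))
      rw [hV n] at h
      exact h.2.1⟩
  -- The block of least index `m` is split off: the union of the others lies in `V (m + 1)`, which
  -- was chosen so that adjoining `d (V m)` leads back into `V m`.
  have hfu : ∀ I : Finset ℕ, I.Nonempty → ∀ n, (∀ i ∈ I, n ≤ i) → I.biUnion D₁.seq ∈ (V n).1 := by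
    intro I
    induction hc : I.card generalizing I with
    | zero => exact fun hI => absurd (Finset.card_eq_zero.1 hc) hI.ne_empty
    | succ k ih =>
      intro hI n hn
      have hm := I.min'_mem hI
      set m := I.min' hI with hmdef
      refine hanti (hn m hm) ?_
      rw [← Finset.insert_erase hm, Finset.biUnion_insert]
      rcases (I.erase m).eq_empty_or_nonempty with he | he
      · rw [he, Finset.biUnion_empty, Finset.union_empty]
        exact hdV (V m)
      · have h := ih (I.erase m) (by rw [Finset.card_erase_of_mem hm, hc]; rfl) he (m + 1)
          fun i hi => lt_of_le_of_ne (I.min'_le i (Finset.mem_of_mem_erase hi))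
            (Finset.ne_of_mem_erase hi).symm
        rw [hV m] at h
        exact h.1.2
  refine ⟨D₁, ?_, ?_⟩
  · rintro _ ⟨n, rfl⟩
    exact hVD n (hdV _)
  · intro s hs t ht hst
    obtain ⟨I, hI, rfl⟩ := InfColl.mem_FU_iff.1 ht
    have hm := I.min'_mem hI
    have hIm := hfu I hI (I.min' hI) fun i hi => I.min'_le i hi
    have hlt : ∀ u ∈ s, ∃ J : Finset ℕ, u = J.biUnion D₁.seq ∧ ∀ j ∈ J, j < I.min' hI := by
      intro u hu
      obtain ⟨J, -, rfl⟩ := InfColl.mem_FU_iff.1 (hs.2 u hu)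
      refine ⟨J, rfl, fun j hj => ?_⟩
      by_contra! hle
      obtain ⟨x, hx⟩ := D₁.nonempty j
      obtain ⟨y, hy⟩ := D₁.nonempty (I.min' hI)
      have hxy := hst _ hu x (Finset.mem_biUnion.2 ⟨j, hj, hx⟩) y
        (Finset.mem_biUnion.2 ⟨_, hm, hy⟩)
      rcases hle.eq_or_lt with he | hl
      · rw [he] at hy
        have hyx := hst _ hu y (Finset.mem_biUnion.2 ⟨j, hj, hy⟩) y
          (Finset.mem_biUnion.2 ⟨_, hm, he ▸ hy⟩)
        exact lt_irrefl _ hyx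
      · exact hxy.asymm (D₁.lt hl y hy x hx)
    -- If `t` starts at index `0`, no block precedes it and `V 0` handles `W ∅`. Otherwise `s` uses
    -- only indices up to `k`, and `V (k + 1)` was cut down by `R` of the block of index `k`.
    rcases hk : I.min' hI with _ | k
    · rw [hk] at hIm hlt
      have : s = ∅ := Finset.eq_empty_of_forall_notMem fun u hu => by
        obtain ⟨J, rfl, hJ⟩ := hlt u hu
        obtain ⟨x, hx⟩ := hs.1.1 _ hu
        obtain ⟨j, hj, -⟩ := Finset.mem_biUnion.1 hx
        exact absurd (hJ j hj) (Nat.not_lt_zero j)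
      rw [this]
      exact hIm.1
    · rw [hk] at hIm hlt
      rw [hV k] at hIm
      refine Set.mem_iInter₂.1 hIm.2.2 s ?_
      rw [Finset.mem_powerset]
      intro u hu
      rw [Finset.mem_powerset]
      intro x hx
      obtain ⟨J, rfl, hJ⟩ := hlt u hu
      obtain ⟨j, hj, hx⟩ := Finset.mem_biUnion.1 hx
      obtain ⟨y, hy⟩ := D₁.nonempty k
      rcases (Nat.lt_succ_iff.1 (hJ j hj)).eq_or_lt with rfl | hjk
      · exact Finset.mem_biUnion.2 ⟨x, hx, Finset.mem_Iic.2 le_rfl⟩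
      · exact Finset.mem_biUnion.2 ⟨y, hy, Finset.mem_Iic.2 (D₁.lt hjk x hx y hy).le⟩

/-! ### Ranked fronts of disjoint collections -/

/-- The collection `s` has rank `α` in the tree of collections approximating members of `B`: either
`s` is a member without proper end-extensions in `B`, or its one-block end-extensions have ranks
smaller than `α` that eventually exceed every ordinal smaller than `α`. -/
inductive BlockRank (B : Set (Finset (Finset ℕ+))) : Ordinal.{0} → Finset (Finset ℕ+) → Prop
  | leaf (s : Finset (Finset ℕ+)) (hs : s ∈ B)
      (hthin : ∀ c ∈ FinColl, c.Nonempty → (∀ u ∈ c, Beyond s u) → s ∪ c ∉ B) : BlockRank B 0 s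
  | node (α : Ordinal.{0}) (s : Finset (Finset ℕ+)) (f : Finset ℕ+ → Ordinal.{0}) (hs : s ∉ B)
      (hlt : ∀ t, t.Nonempty → Beyond s t → f t < α)
      (hlim : ∀ η < α, ∃ N, ∀ t, t.Nonempty → Above N t → η ≤ f t)
      (hrank : ∀ t, t.Nonempty → Beyond s t → BlockRank B (f t) (insert t s)) : BlockRank B α s

/-- Along the ultrafilter, the end-extensions of `s` in `B` belong to `P`. -/
inductive Decides (U : Ultrafilter (Finset ℕ+)) (B P : Set (Finset (Finset ℕ+))) :
    Finset (Finset ℕ+) → Prop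
  | leaf (s : Finset (Finset ℕ+)) (hs : s ∈ B) (hP : s ∈ P) : Decides U B P s
  | node (s : Finset (Finset ℕ+)) (W : Set (Finset ℕ+)) (hs : s ∉ B) (hW : W ∈ U)
      (h : ∀ t ∈ W, Decides U B P (insert t s)) : Decides U B P s

/-- Induction on the rank: if the extensions are not almost all decided for `P`, then almost all are
decided for `Pᶜ`, because an ultrafilter contains a set or its complement. -/
theorem BlockRank.decides_or {B : Set (Finset (Finset ℕ+))} {U : Ultrafilter (Finset ℕ+)}
    (hU : ∀ N, ∀ᶠ t in (U : Filter (Finset ℕ+)), t.Nonempty ∧ Above N t)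
    (P : Set (Finset (Finset ℕ+))) {α : Ordinal.{0}} {s : Finset (Finset ℕ+)}
    (h : BlockRank B α s) : Decides U B P s ∨ Decides U B Pᶜ s := by
  induction h with
  | leaf s hs =>
    by_cases hP : s ∈ P
    exacts [Or.inl (.leaf s hs hP), Or.inr (.leaf s hs hP)]
  | node α s f hs _ _ _ ih =>
    by_cases hW : ∀ᶠ t in (U : Filter (Finset ℕ+)), Decides U B P (insert t s)
    · exact Or.inl (.node s _ hs hW fun t ht => ht)
    · obtain ⟨N, hN⟩ := exists_bound s
      refine Or.inr (.node s {t | Decides U B Pᶜ (insert t s)} hs ?_ fun t ht => ht)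
      filter_upwards [hU N, Ultrafilter.eventually_not.2 hW] with t ht hnt
      exact (ih t ht.1 (ht.2.beyond hN)).resolve_left hnt

/-- Diagonalizing over the sets that witness the decision at each node forces every branch inside
`D₁` to follow the decision down to its leaf. -/
theorem Decides.exists_homogeneous {B P : Set (Finset (Finset ℕ+))}
    {U : Ultrafilter (Finset ℕ+)} {D : InfColl}
    (hU : ∀ N, ∀ᶠ t in (U : Filter (Finset ℕ+)), t ∈ FU D.blocks ∧ Above N t)
    (hUU : ∀ p : Finset ℕ+ → Prop, (∀ᶠ t in (U : Filter (Finset ℕ+)), p t) →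
      ∀ᶠ t in (U : Filter (Finset ℕ+)), ∀ᶠ u in (U : Filter (Finset ℕ+)), p (t ∪ u))
    {α : Ordinal.{0}} (hB : BlockRank B α ∅) (h : Decides U B P ∅) :
    ∃ D₁ : InfColl, D₁.Below D ∧ ∀ s ∈ B ∩ FinCollOf D₁, s ∈ P := by
  have hW : ∀ s, ∃ W ∈ U, s ∉ B → Decides U B P s → ∀ t ∈ W, Decides U B P (insert t s) := by
    intro s
    by_cases hs : s ∉ B ∧ Decides U B P s
    · obtain ⟨hs, hd⟩ := hs
      cases hd with
      | leaf _ hs' => exact absurd hs' hs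
      | node _ W _ hW h => exact ⟨W, hW, fun _ _ => h⟩
    · exact ⟨Set.univ, Filter.univ_mem, fun h₁ h₂ => absurd ⟨h₁, h₂⟩ hs⟩
  choose W hWU hW using hW
  obtain ⟨D₁, hD₁, hdiag⟩ := exists_diagonal_collection D U hU hUU W hWU
  have key : ∀ α s, BlockRank B α s → s ∈ FinCollOf D₁ → Decides U B P s →
      ∀ c ∈ FinCollOf D₁, (∀ u ∈ c, Beyond s u) → s ∪ c ∈ B → s ∪ c ∈ P := by
    intro α s hr
    induction hr with
    | leaf s hs hthin =>
      intro _ hd c hc hsc hB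
      rcases c.eq_empty_or_nonempty with rfl | hne
      · rw [Finset.union_empty]
        cases hd with
        | leaf _ _ hP => exact hP
        | node _ _ hs' => exact absurd hs hs'
      · exact absurd hB (hthin c hc.1 hne hsc)
    | node α s f hs _ _ _ ih =>
      intro hsD hd c hc hsc hB
      rcases c.eq_empty_or_nonempty with rfl | hne
      · rw [Finset.union_empty] at hB
        exact absurd hB hs
      · obtain ⟨t, c', rfl, ht, htc⟩ := exists_first hc.1 hne
        have htD : t ∈ FU D₁.blocks := hc.2 t (by simp)
        have hst : Beyond s t := hsc t (by simp)
        rw [Finset.union_insert, ← Finset.insert_union] at hB ⊢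
        exact ih t ht hst (insert_mem_FinCollOf hsD htD hst)
          (hW s hs hd t (hdiag s hsD t htD hst)) c'
          (FinCollOf_subset hc (Finset.subset_insert t c'))
          (fun u hu => (hsc u (by simp [hu])).insert (htc u hu)) hB
  refine ⟨D₁, hD₁, fun s hs => ?_⟩
  simpa using key α ∅ hB (empty_mem_FinCollOf D₁) h s hs.2
    (fun u _ v hv => absurd hv (Finset.notMem_empty v)) (by simpa using hs.1)

/-- The Ramsey theorem for ranked fronts of disjoint collections. -/
theorem BlockRank.ramsey {B : Set (Finset (Finset ℕ+))} {α : Ordinal.{0}}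
    (hB : BlockRank B α ∅) (P : Set (Finset (Finset ℕ+))) (D : InfColl) :
    ∃ D₁ : InfColl, D₁.Below D ∧
      ((∀ s ∈ B ∩ FinCollOf D₁, s ∈ P) ∨ ∀ s ∈ B ∩ FinCollOf D₁, s ∉ P) := by
  obtain ⟨U, hU, hUU⟩ := exists_union_idempotent D
  rcases hB.decides_or (U := U) (fun N => (hU N).mono fun t ht =>
    ⟨InfColl.nonempty_of_mem_FU ht.1, ht.2⟩) P with h | h
  · obtain ⟨D₁, hD₁, h₁⟩ := h.exists_homogeneous hU hUU hB
    exact ⟨D₁, hD₁, Or.inl h₁⟩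
  · obtain ⟨D₁, hD₁, h₁⟩ := h.exists_homogeneous hU hUU hB
    exact ⟨D₁, hD₁, Or.inr h₁⟩

/-! ### Ranks of fronts against iterated derivatives -/

/-- The surplus derivation at `s` provides one extension by `t` in the derivative of order `α`, and
`f t + 1 ≤ α` leaves a surplus for that extension. At a leaf it is spent on membership in `FinCollOf
D`. -/
theorem BlockRank.exists_mem_of_mem_iterDeriv {B F : Set (Finset (Finset ℕ+))}
    {D : InfColl} {α : Ordinal.{0}} {s : Finset (Finset ℕ+)} (h : BlockRank B α s)
    (hs : s ∈ iterDeriv D F (α + 1)) : ∃ b ∈ B ∩ FinCollOf D, b ∈ F := by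
  induction h with
  | leaf s hsB =>
    rw [iterDeriv_add_one, iterDeriv_zero] at hs
    exact ⟨s, ⟨hsB, hs.1.2⟩, hs.1.1⟩
  | node α s f _ hlt _ _ ih =>
    rw [iterDeriv_add_one] at hs
    obtain ⟨t, ht, hst, hts⟩ := exists_insert_mem_of_mem_strongDeriv hs
    have hne := InfColl.nonempty_of_mem_FU ht
    exact ih t hne hst (iterDeriv_antitone D F (Order.add_one_le_of_lt (hlt t hne hst)) hts)

/-- By induction an extension by `t` survives `f t` derivations, and heredity passes this to `s`.
Since `f t` eventually exceeds each `η < α`, `s` survives `η + 1` derivations. -/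
theorem BlockRank.mem_iterDeriv {B F : Set (Finset (Finset ℕ+))} {D : InfColl}
    (hF : IsDownClosed F) {α : Ordinal.{0}} {s : Finset (Finset ℕ+)} (h : BlockRank B α s)
    (hs : s ∈ FinCollOf D) (hB : ∀ b ∈ B ∩ FinCollOf D, s ⊆ b → b ∈ F) :
    s ∈ iterDeriv D F α := by
  induction h with
  | leaf s hsB =>
    rw [iterDeriv_zero]
    exact hB s ⟨hsB, hs⟩ subset_rfl
  | node α s f _ hlt hlim _ ih =>
    have hext : ∀ t ∈ FU D.blocks, Beyond s t → insert t s ∈ iterDeriv D F (f t) :=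
      fun t ht hst => ih t (InfColl.nonempty_of_mem_FU ht) hst (insert_mem_FinCollOf hs ht hst)
        fun b hb hsb => hB b hb ((Finset.subset_insert t s).trans hsb)
    have hmem : ∀ t ∈ FU D.blocks, Beyond s t → s ∈ iterDeriv D F (f t) := fun t ht hst =>
      (hF.iterDeriv D _).subset_mem (hext t ht hst) (insert_mem_FinCollOf hs ht hst).1
        (Finset.subset_insert t s)
    obtain ⟨M, hM⟩ := exists_bound s
    have hevent : ∀ η < α, ∃ N, ∀ t ∈ FU D.blocks, Above N t → Beyond s t ∧ η ≤ f t := by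
      intro η hη
      obtain ⟨N, hN⟩ := hlim η hη
      exact ⟨max M N, fun t ht hta => ⟨(hta.mono (le_max_left _ _)).beyond hM,
        hN t (InfColl.nonempty_of_mem_FU ht) (hta.mono (le_max_right _ _))⟩⟩
    refine mem_iterDeriv_of_forall_lt ?_ fun η hη => ?_
    · obtain ⟨t, ht, hta⟩ := D.exists_above M
      exact iterDeriv_subset D F _ (hmem t ht (hta.beyond hM))
    · obtain ⟨N, hN⟩ := hevent η hη
      rw [iterDeriv_add_one, mem_strongDeriv_iff]
      refine ⟨?_, hs, N, fun t ht hta => ?_⟩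
      · obtain ⟨t, ht, hta⟩ := D.exists_above N
        exact iterDeriv_antitone D F (hN t ht hta).2 (hmem t ht (hN t ht hta).1)
      · exact iterDeriv_antitone D F (hN t ht hta).2 (hext t ht (hN t ht hta).1)

theorem BlockRank.exists_extension {B : Set (Finset (Finset ℕ+))} {α : Ordinal.{0}}
    {s : Finset (Finset ℕ+)} (h : BlockRank B α s) :
    ∃ c : Finset (Finset ℕ+), (∀ u ∈ c, u.Nonempty ∧ Beyond s u) ∧ s ∪ c ∈ B := by
  induction h with
  | leaf s hs => exact ⟨∅, by simp, by simpa using hs⟩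
  | node α s f _ _ _ _ ih =>
    obtain ⟨M, hM⟩ := exists_bound s
    have hst : Beyond s {M.succPNat} := Above.beyond (N := M) (by simp [Above]) hM
    obtain ⟨c, hc, hB⟩ := ih {M.succPNat} (by simp) hst
    refine ⟨insert {M.succPNat} c, fun u hu => ?_, ?_⟩
    · rcases Finset.mem_insert.1 hu with rfl | hu
      · exact ⟨by simp, hst⟩
      · exact ⟨(hc u hu).1, fun v hv => (hc u hu).2 v (by simp [hv])⟩
    · rwa [Finset.union_insert, ← Finset.insert_union]

theorem isInitialSeg_union {s c : Finset (Finset ℕ+)} (hs : ∀ u ∈ s, u.Nonempty)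
    (hc : ∀ u ∈ c, u.Nonempty ∧ Beyond s u) : IsInitialSeg s (s ∪ c) := by
  refine ⟨Finset.subset_union_left, fun u hu v hv huv => ?_⟩
  rcases Finset.mem_union.1 hu with hu | hu
  · exact hu
  · exact absurd huv (((hc u hu).2 v hv).not_symm (hs v hv) (hc u hu).1)

/-- Reading the blocks of `s` in order follows a branch of the tree, which either reaches a leaf or
is still at a ranked node when `s` is exhausted. -/
theorem BlockRank.exists_subset_mem_or {B : Set (Finset (Finset ℕ+))} {α : Ordinal.{0}}
    (h : BlockRank B α ∅) {s : Finset (Finset ℕ+)} (hs : s ∈ FinColl) :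
    (∃ b ∈ B, b ⊆ s) ∨ ∃ β, BlockRank B β s := by
  refine FinColl.induction (p := fun s => (∃ b ∈ B, b ⊆ s) ∨ ∃ β, BlockRank B β s)
    (Or.inr ⟨α, h⟩) (fun t s _ ht hst ih => ?_) hs
  · rcases ih with ⟨b, hb, hbs⟩ | ⟨β, hβ⟩
    · exact Or.inl ⟨b, hb, hbs.trans (Finset.subset_insert t s)⟩
    · cases hβ with
      | leaf _ hsB => exact Or.inl ⟨s, hsB, Finset.subset_insert t s⟩
      | node _ _ f _ _ _ hr => exact Or.inr ⟨_, hr t ht hst⟩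

theorem BlockRank.subset_compl_iff {B F : Set (Finset (Finset ℕ+))} {α : Ordinal.{0}}
    (h : BlockRank B α ∅) (hF : IsDownClosed F) (D : InfColl) :
    B ∩ FinCollOf D ⊆ FinColl \ F ↔ F ∩ FinCollOf D ⊆ initialClosure B \ B := by
  constructor
  · rintro hB s ⟨hsF, hsD⟩
    have hsB : ∀ b ∈ B, ¬ b ⊆ s := fun b hb hbs =>
      (hB ⟨hb, FinCollOf_subset hsD hbs⟩).2 (hF.subset_mem hsF hsD.1 hbs)
    refine ⟨?_, fun hs => hsB s hs subset_rfl⟩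
    rcases h.exists_subset_mem_or hsD.1 with ⟨b, hb, hbs⟩ | ⟨β, hβ⟩
    · exact absurd hbs (hsB b hb)
    · obtain ⟨c, hc, hscB⟩ := hβ.exists_extension
      exact Or.inl ⟨hsD.1, _, hscB, isInitialSeg_union hsD.1.1 hc⟩
  · rintro hB s ⟨hsB, hsD⟩
    exact ⟨hsD.1, fun hsF => (hB ⟨hsF, hsD⟩).2 hsB⟩

/-! ### Pointwise closed families -/

theorem charFn_eq_true {s : Finset (Finset ℕ+)} {u : Finset ℕ+} : charFn s u = true ↔ u ∈ s := by
  simp [charFn]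

theorem isOpen_agree (C : Finset (Finset ℕ+)) (g : Finset ℕ+ → Bool) :
    IsOpen {h : Finset ℕ+ → Bool | ∀ u ∈ C, h u = g u} := by
  have : {h : Finset ℕ+ → Bool | ∀ u ∈ C, h u = g u} = ⋂ u ∈ C, (fun h => h u) ⁻¹' {g u} := by
    ext h
    simp
  rw [this]
  exact isOpen_biInter_finset fun u _ => (isOpen_discrete _).preimage (continuous_apply u)

theorem exists_agree_of_mem_closure {G : Set (Finset (Finset ℕ+))} {g : Finset ℕ+ → Bool}
    (hg : g ∈ closure (charFn '' G)) (C : Finset (Finset ℕ+)) :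
    ∃ s ∈ G, ∀ u ∈ C, charFn s u = g u := by
  obtain ⟨_, h, s, hs, rfl⟩ := mem_closure_iff.1 hg _ (isOpen_agree C g) fun _ _ => rfl
  exact ⟨s, hs, h⟩

theorem mem_closure_of_exists_agree {G : Set (Finset (Finset ℕ+))} {g : Finset ℕ+ → Bool}
    (h : ∀ C : Finset (Finset ℕ+), ∃ s ∈ G, ∀ u ∈ C, charFn s u = g u) :
    g ∈ closure (charFn '' G) := by
  rw [mem_closure_iff]
  intro O hO hgO
  obtain ⟨C, v, hv, hCO⟩ := isOpen_pi_iff.1 hO g hgO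
  obtain ⟨s, hs, hsC⟩ := h C
  exact ⟨charFn s, hCO fun u hu => (hsC u hu) ▸ (hv u hu).2, s, hs, rfl⟩

theorem Below.finite_subset {D₁ D₂ : InfColl} (h : D₁.Below D₂) {s : Finset (Finset ℕ+)}
    (hs : ∀ u ∈ s, u ∈ D₁.blocks) : s ∈ FinCollOf D₂ := by
  refine ⟨⟨fun u hu => ?_, fun u hu v hv huv => ?_⟩, fun u hu => h (hs u hu)⟩
  · obtain ⟨n, rfl⟩ := hs u hu
    exact D₁.nonempty n
  · obtain ⟨i, rfl⟩ := hs u hu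
    obtain ⟨j, rfl⟩ := hs v hv
    rcases lt_trichotomy i j with hij | rfl | hij
    exacts [Or.inl (D₁.lt hij), absurd rfl huv, Or.inr (D₁.lt hij)]

/-- Otherwise the characteristic function of the infinite set `D₁.blocks` would be a limit of those
of its finite parts, hence itself that of a finite collection. -/
theorem PointwiseClosed.exists_finite_notMem {F : Set (Finset (Finset ℕ+))} {D : InfColl}
    (h : PointwiseClosed (F ∩ FinCollOf D)) {D₁ : InfColl} (hD : D₁.Below D) :
    ∃ s : Finset (Finset ℕ+), (∀ u ∈ s, u ∈ D₁.blocks) ∧ s ∉ F := by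
  classical
  by_contra! hF
  let g : Finset ℕ+ → Bool := fun u => decide (u ∈ D₁.blocks)
  have hg : g ∈ closure (charFn '' (F ∩ FinCollOf D)) := by
    refine mem_closure_of_exists_agree fun C => ?_
    have hC : ∀ u ∈ C.filter (· ∈ D₁.blocks), u ∈ D₁.blocks := fun u hu =>
      (Finset.mem_filter.1 hu).2
    refine ⟨C.filter (· ∈ D₁.blocks), ⟨hF _ hC, Below.finite_subset hD hC⟩, fun u hu => ?_⟩
    rw [Bool.eq_iff_iff, charFn_eq_true]
    simp [g, hu]
  rw [IsClosed.closure_eq h] at hg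
  obtain ⟨s, -, hs⟩ := hg
  obtain ⟨N, hN⟩ := exists_bound s
  have hmem : D₁.seq N ∈ s := by
    rw [← charFn_eq_true, hs]
    simp [g, InfColl.blocks]
  obtain ⟨x, hx⟩ := D₁.nonempty N
  exact absurd (hN _ hmem x hx) (D₁.above N x hx).not_ge

theorem IsDownClosed.exists_of_not_closed {F : Set (Finset (Finset ℕ+))} (hF : IsDownClosed F)
    {D : InfColl} (h : ¬ PointwiseClosed (F ∩ FinCollOf D)) :
    ∃ D₁ : InfColl, D₁.Below D ∧ FinCollOf D₁ ⊆ F := by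
  rw [PointwiseClosed, ← closure_subset_iff_isClosed, Set.not_subset] at h
  obtain ⟨g, hg, hgn⟩ := h
  have hfin : ∀ C : Finset (Finset ℕ+), (∀ u ∈ C, g u = true) → C ∈ F ∩ FinCollOf D := by
    intro C hC
    obtain ⟨s, ⟨hsF, hsD⟩, hs⟩ := exists_agree_of_mem_closure hg C
    have hCs : C ⊆ s := fun u hu => charFn_eq_true.1 ((hs u hu).trans (hC u hu))
    exact ⟨hF.subset_mem hsF hsD.1 hCs, FinCollOf_subset hsD hCs⟩
  have hinf : ∀ N, ∃ t ∈ {u | g u = true}, t.Nonempty ∧ Above N t := by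
    intro N
    by_contra! hN
    -- all blocks on which `g` is true meet the initial interval, so there are finitely many
    have hmeet : ∀ t, g t = true → t.Nonempty ∧ ∃ x ∈ t, (x : ℕ) ≤ N := by
      intro t ht
      have hne : t.Nonempty := (hfin {t} (by simpa using ht)).2.1.1 t (by simp)
      refine ⟨hne, ?_⟩
      have := hN t ht hne
      simpa [Above] using this
    -- Any two blocks in the support belong to a common disjoint collection, so distinct blocks have
    -- distinct minima; these are bounded, which makes the support finite.
    have hinj : Set.InjOn blockMin {t | g t = true} := by
      intro t ht u hu htu
      by_contra hne
      have hc := (hfin {t, u} (by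
        intro v hv
        rcases Finset.mem_insert.1 hv with rfl | hv
        · exact ht
        · rwa [Finset.mem_singleton.1 hv])).2.1
      have hlt := BlockLT_of_blockMin_lt hc (u := t) (v := u) (by simp) (by simp) hne htu.le
      exact absurd htu (hlt.blockMin_lt (hmeet t ht).1 (hmeet u hu).1).ne
    have hfinite : {t | g t = true}.Finite := by
      refine Set.Finite.of_finite_image (Set.Finite.subset
        (Set.finite_Iic N.succPNat) ?_) hinj
      rintro _ ⟨t, ht, rfl⟩
      obtain ⟨-, x, hx, hxN⟩ := hmeet t ht
      refine (blockMin_le hx).trans ?_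
      rw [← PNat.coe_le_coe]
      exact hxN.trans (Nat.le_succ N)
    refine hgn ⟨hfinite.toFinset, hfin _ (by simp), ?_⟩
    funext u
    rw [Bool.eq_iff_iff, charFn_eq_true]
    simp
  obtain ⟨E, hE⟩ := exists_infColl hinf
  have hED : E.Below D := fun u hu => (hfin {u} (by simpa using hE hu)).2.2 u (by simp)
  refine ⟨E, hED, fun s hs => ?_⟩
  have hJ : ∀ u : Finset ℕ+, ∃ J : Finset (Finset ℕ+), u ∈ s →
      J.Nonempty ∧ (∀ v ∈ J, v ∈ E.blocks) ∧ u = J.biUnion id := by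
    intro u
    by_cases hu : u ∈ s
    · obtain ⟨J, hJ⟩ := hs.2 u hu
      exact ⟨J, fun _ => hJ⟩
    · exact ⟨∅, fun h => absurd h hu⟩
  choose J hJ using hJ
  -- The blocks of `E` that make up the members of `s` form a finite part of the support, so
  -- heredity applies to them.
  refine hF (s.biUnion J) (hfin _ fun v hv => ?_).1 s hs.1 fun u hu => ?_
  · obtain ⟨u, hu, hv⟩ := Finset.mem_biUnion.1 hv
    exact hE ((hJ u hu).2.1 v hv)
  · exact ⟨J u, (hJ u hu).1, fun v hv => Finset.mem_biUnion.2 ⟨u, hu, hv⟩, (hJ u hu).2.2⟩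

/-! ### Countability of the strong index -/

/-- If a property of the empty collection passes to some one-block end-extension whenever it holds,
then it holds for all initial segments of some infinite collection. -/
theorem exists_infColl_of_extension {p : Finset (Finset ℕ+) → Prop} (h₀ : p ∅)
    (h : ∀ s, p s → ∃ t, t.Nonempty ∧ Beyond s t ∧ p (insert t s)) :
    ∃ E : InfColl, ∀ n, p ((Finset.range n).image E.seq) := by
  choose f hne hb hp using h
  let g : ℕ → {s // p s} := fun n =>
    Nat.rec ⟨∅, h₀⟩ (fun _ s => ⟨insert (f s.1 s.2) s.1, hp s.1 s.2⟩) n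
  have hg : ∀ n, (g (n + 1)).1 = insert (f (g n).1 (g n).2) (g n).1 := fun n => rfl
  have hE : ∀ n, (Finset.range n).image (fun n => f (g n).1 (g n).2) = (g n).1 := by
    intro n
    induction n with
    | zero => rfl
    | succ n ih => rw [Finset.range_add_one, Finset.image_insert, ih, hg]
  refine ⟨⟨fun n => f (g n).1 (g n).2, fun n => hne _ _, fun n => hb _ (g (n + 1)).2 _ ?_⟩, ?_⟩
  · rw [hg]
    simp
  · intro n
    simp only [hE]
    exact (g n).2

theorem isSuccLimit_omega_one : Order.IsSuccLimit (Ordinal.omega.{0} 1) :=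
  Cardinal.ord_aleph 1 ▸ Cardinal.isSuccLimit_ord (Cardinal.aleph0_le_aleph 1)

/-- The bound must be uniform in `D₁` for the supremum of the indices to be countable. Failure of a
uniform bound passes to a one-block extension, and the resulting infinite collection contradicts
closedness. -/
theorem PointwiseClosed.exists_countable_bound {F : Set (Finset (Finset ℕ+))} {D : InfColl}
    (hF : IsDownClosed F) (h₀ : ∅ ∈ F) (h : PointwiseClosed (F ∩ FinCollOf D)) :
    ∃ α < Ordinal.omega 1, ∀ D₁ : InfColl, D₁.Below D → ∀ ζ, ∅ ∈ iterDeriv D₁ F ζ → ζ ≤ α := by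
  by_contra hbad
  let Bounded : Finset (Finset ℕ+) → Prop := fun s => ∃ α < Ordinal.omega 1,
    ∀ D₁ : InfColl, D₁.Below D → ∀ ζ, s ∈ iterDeriv D₁ F ζ → ζ ≤ α
  obtain ⟨E, hE⟩ := exists_infColl_of_extension
    (p := fun s => s ∈ F ∩ FinCollOf D ∧ ¬ Bounded s) ⟨⟨h₀, empty_mem_FinCollOf D⟩, hbad⟩ (by
      rintro s ⟨⟨hsF, hsD⟩, hs⟩
      by_contra hext
      have hbd : ∀ t : Finset ℕ+, ∃ α < Ordinal.omega 1,
          t.Nonempty → Beyond s t → insert t s ∈ F ∩ FinCollOf D →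
          ∀ D₁ : InfColl, D₁.Below D → ∀ ζ, insert t s ∈ iterDeriv D₁ F ζ → ζ ≤ α := by
        intro t
        by_cases ht : t.Nonempty ∧ Beyond s t ∧ insert t s ∈ F ∩ FinCollOf D
        · obtain ⟨ht₁, ht₂, ht₃⟩ := ht
          by_contra hn
          refine hext ⟨t, ht₁, ht₂, ht₃, ?_⟩
          rintro ⟨α, hα, hb⟩
          exact hn ⟨α, hα, fun _ _ _ => hb⟩
        · exact ⟨0, Ordinal.omega_pos 1, fun h₁ h₂ h₃ => absurd ⟨h₁, h₂, h₃⟩ ht⟩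
      choose α hα hb using hbd
      -- A supremum over the countably many blocks `t`, hence still countable.
      refine hs ⟨⨆ t, (α t + 1),
        Ordinal.iSup_lt_omega_one fun t => isSuccLimit_omega_one.add_one_lt (hα t),
        fun D₁ hD₁ ζ hζ => le_of_forall_lt fun η hη => ?_⟩
      have hsη := iterDeriv_antitone D₁ F (Order.add_one_le_of_lt hη) hζ
      rw [iterDeriv_add_one] at hsη
      obtain ⟨t, ht, hst, hts⟩ := exists_insert_mem_of_mem_strongDeriv hsη
      have hle := hb t (InfColl.nonempty_of_mem_FU ht) hst
        ⟨iterDeriv_subset _ _ _ hts, insert_mem_FinCollOf hsD (FU_subset_FU hD₁ ht) hst⟩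
        D₁ hD₁ η hts
      exact (Order.lt_add_one_iff.2 hle).trans_le
        (Ordinal.le_iSup (fun t => α t + 1) t))
  have hED : E.Below D := by
    rintro _ ⟨n, rfl⟩
    exact (hE (n + 1)).1.2.2 _ (Finset.mem_image.2 ⟨n, by simp, rfl⟩)
  obtain ⟨s, hs, hsF⟩ := h.exists_finite_notMem hED
  obtain ⟨N, hN⟩ := exists_bound s
  refine hsF (hF.subset_mem (hE (N + 1)).1.1 (hE (N + 1)).1.2.1 fun u hu => ?_)
  obtain ⟨n, rfl⟩ := hs u hu
  obtain ⟨x, hx⟩ := E.nonempty n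
  have := (E.above n x hx).trans_le (hN _ hu x hx)
  exact Finset.mem_image.2 ⟨n, by simp; omega, rfl⟩

/-- By heredity a derivative is non-empty exactly when it contains `∅`, so the index is read off
from `∅` alone. -/
theorem lt_strongIndex_iff {D : InfColl} {F : Set (Finset (Finset ℕ+))} (hF : IsDownClosed F)
    (h : ∃ ζ, iterDeriv D F ζ = ∅) {ξ : Ordinal.{0}} :
    ξ < strongIndex D F ↔ ∅ ∈ iterDeriv D F ξ := by
  constructor
  · intro hξ
    by_contra hn
    refine (csInf_le' ?_ : strongIndex D F ≤ ξ).not_gt hξ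
    by_contra hne
    exact hn ((hF.iterDeriv D ξ).empty_mem (Set.nonempty_iff_ne_empty.2 hne))
  · intro hξ
    by_contra! hle
    have h₁ : iterDeriv D F (strongIndex D F) = ∅ := csInf_mem h
    exact Set.notMem_empty _ (h₁ ▸ iterDeriv_antitone D F hle hξ)

theorem exists_iterDeriv_eq_empty {D : InfColl} {F : Set (Finset (Finset ℕ+))}
    (hF : IsDownClosed F) {α : Ordinal.{0}} (h : ∀ ζ, ∅ ∈ iterDeriv D F ζ → ζ ≤ α) :
    iterDeriv D F (α + 1) = ∅ := by
  by_contra hne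
  exact (Order.lt_add_one_iff.2 le_rfl).not_ge
    (h _ ((hF.iterDeriv D _).empty_mem (Set.nonempty_iff_ne_empty.2 hne)))

theorem strongIndex_le {D : InfColl} {F : Set (Finset (Finset ℕ+))}
    {α : Ordinal.{0}} (h : iterDeriv D F α = ∅) : strongIndex D F ≤ α := csInf_le' h

theorem strongIndex_le_supIndex {D D₁ : InfColl} {F : Set (Finset (Finset ℕ+))} {α : Ordinal.{0}}
    (h : ∀ D₂ : InfColl, D₂.Below D → strongIndex D₂ F ≤ α) (hD : D₁.Below D) :
    strongIndex D₁ F ≤ supIndex D F :=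
  le_csSup ⟨α, by rintro _ ⟨D₂, hD₂, rfl⟩; exact h D₂ hD₂⟩ ⟨D₁, hD, rfl⟩

theorem supIndex_le {D : InfColl} {F : Set (Finset (Finset ℕ+))} {α : Ordinal.{0}}
    (h : ∀ D₂ : InfColl, D₂.Below D → strongIndex D₂ F ≤ α) : supIndex D F ≤ α :=
  csSup_le' (by rintro _ ⟨D₂, hD₂, rfl⟩; exact h D₂ hD₂)

theorem exists_lt_strongIndex {D : InfColl} {F : Set (Finset (Finset ℕ+))} {ξ : Ordinal.{0}}
    (h : ξ < supIndex D F) : ∃ D₁ : InfColl, D₁.Below D ∧ ξ < strongIndex D₁ F := by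
  by_contra! hn
  exact (supIndex_le hn).not_gt h

/-- The main dichotomies for a ranked front of disjoint collections. -/
theorem BlockRank.trichotomy {B F : Set (Finset (Finset ℕ+))} {D : InfColl} {ξ : Ordinal.{0}}
    (hB : BlockRank B ξ ∅) (hBF : B ⊆ FinColl) (hF : IsDownClosed F) {α : Ordinal.{0}}
    (hα : ∀ D₁ : InfColl, D₁.Below D → iterDeriv D₁ F α = ∅) :
    (ξ + 1 < supIndex D F → ∃ D₂ : InfColl, D₂.Below D ∧ B ∩ FinCollOf D₂ ⊆ F) ∧
    (supIndex D F < ξ + 1 → ∀ D₁ : InfColl, D₁.Below D →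
      ∃ D₂ : InfColl, D₂.Below D₁ ∧ B ∩ FinCollOf D₂ ⊆ FinColl \ F) ∧
    ∃ D₂ : InfColl, D₂.Below D ∧
      (B ∩ FinCollOf D₂ ⊆ F ∨ B ∩ FinCollOf D₂ ⊆ FinColl \ F) := by
  refine ⟨fun hξ => ?_, fun hξ D₁ hD₁ => ?_, ?_⟩
  · obtain ⟨D₁, hD₁, hlt⟩ := exists_lt_strongIndex hξ
    obtain ⟨D₂, hD₂, h | h⟩ := hB.ramsey F D₁
    · exact ⟨D₂, hD₂.trans hD₁, h⟩
    · have hmem := (lt_strongIndex_iff hF ⟨α, hα D₁ hD₁⟩).1 hlt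
      obtain ⟨b, hb, hbF⟩ := hB.exists_mem_of_mem_iterDeriv
        (iterDeriv_mono_below hD₂ F _ ⟨hmem, empty_mem_FinCollOf D₂⟩)
      exact absurd hbF (h b hb)
  · obtain ⟨D₂, hD₂, h | h⟩ := hB.ramsey F D₁
    -- With the whole front inside `F`, `∅` would survive `ξ` derivations on `D₂`, giving `ξ <
    -- strongIndex D₂ F ≤ supIndex D F ≤ ξ`.
    · have hD := hD₂.trans hD₁
      have hmem := hB.mem_iterDeriv hF (empty_mem_FinCollOf D₂) fun b hb _ => h b hb
      have h₁ := (lt_strongIndex_iff hF ⟨α, hα D₂ hD⟩).2 hmem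
      have h₂ := strongIndex_le_supIndex (fun D₃ hD₃ => strongIndex_le (hα D₃ hD₃)) hD
      exact absurd (h₁.trans_le h₂) (Order.lt_add_one_iff.1 hξ).not_gt
    · exact ⟨D₂, hD₂, fun s hs => ⟨hBF hs.1, h s hs⟩⟩
  · obtain ⟨D₂, hD₂, h | h⟩ := hB.ramsey F D
    · exact ⟨D₂, hD₂, Or.inl h⟩
    · exact ⟨D₂, hD₂, Or.inr fun s hs => ⟨hBF hs.1, h s hs⟩⟩

/-! ### Cantor normal forms written as lists of exponents -/

/-- The sum of the powers of `ω` with the listed exponents. -/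
noncomputable def sumPow (l : List Ordinal.{0}) : Ordinal.{0} :=
  (l.map fun b => Ordinal.omega0 ^ b).sum

theorem sumPow_cons (b : Ordinal.{0}) (l : List Ordinal.{0}) :
    sumPow (b :: l) = Ordinal.omega0 ^ b + sumPow l := by simp [sumPow]

theorem sumPow_singleton (b : Ordinal.{0}) : sumPow [b] = Ordinal.omega0 ^ b := by simp [sumPow]

theorem sumPow_ofFn {r : ℕ} (b : Fin r → Ordinal.{0}) :
    (List.ofFn fun i => Ordinal.omega0 ^ b i).sum = sumPow (List.ofFn b) := by
  rw [sumPow, List.map_ofFn]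
  rfl

theorem sumPow_lt {l : List Ordinal.{0}} {e : Ordinal.{0}} (h : ∀ c ∈ l, c < e) :
    sumPow l < Ordinal.omega0 ^ e := by
  induction l with
  | nil => exact Ordinal.opow_pos e Ordinal.omega0_pos
  | cons b l ih =>
    rw [sumPow_cons]
    exact Ordinal.isPrincipal_add_omega0_opow e
      ((Ordinal.opow_lt_opow_iff_right Ordinal.one_lt_omega0).2 (h b (by simp)))
      (ih fun c hc => h c (by simp [hc]))

theorem opow_le_sumPow {l : List Ordinal.{0}} {b : Ordinal.{0}} (h : b ∈ l) :
    Ordinal.omega0 ^ b ≤ sumPow l := by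
  induction l with
  | nil => simp at h
  | cons c l ih =>
    rw [sumPow_cons]
    rcases List.mem_cons.1 h with rfl | h
    · exact le_self_add
    · exact (ih h).trans le_add_self

/-- Exponents all below `b` sum to less than `ω ^ b`, so leading exponents agree and can be
cancelled. This uniqueness lets the index of a Schreier set determine the rule that produced it. -/
theorem sumPow_injective {l l' : List Ordinal.{0}} (hl : l.Pairwise (· ≥ ·))
    (hl' : l'.Pairwise (· ≥ ·)) (h : sumPow l = sumPow l') : l = l' := by
  have hpos : ∀ (b : Ordinal.{0}) l, sumPow (b :: l) ≠ 0 := fun b l =>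
    ((Ordinal.opow_pos b Ordinal.omega0_pos).trans_le (opow_le_sumPow (by simp))).ne'
  have hle : ∀ {a b : Ordinal.{0}} {t t' : List Ordinal.{0}}, (a :: t).Pairwise (· ≥ ·) →
      sumPow (a :: t) = sumPow (b :: t') → b ≤ a := by
    intro a b t t' ht h
    by_contra! hab
    have h₁ : sumPow (a :: t) < Ordinal.omega0 ^ b := sumPow_lt fun c hc => by
      rcases List.mem_cons.1 hc with rfl | hc
      · exact hab
      · exact ((List.pairwise_cons.1 ht).1 c hc).trans_lt hab
    exact h₁.not_ge (h ▸ opow_le_sumPow (by simp))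
  induction l generalizing l' with
  | nil =>
    cases l' with
    | nil => rfl
    | cons b t' => exact absurd h.symm (hpos b t')
  | cons a t ih =>
    cases l' with
    | nil => exact absurd h (hpos a t)
    | cons b t' =>
      obtain rfl : a = b := le_antisymm (hle hl' h.symm) (hle hl h)
      rw [sumPow_cons, sumPow_cons, add_right_inj] at h
      rw [ih (List.pairwise_cons.1 hl).2 (List.pairwise_cons.1 hl').2 h]

theorem exists_sumPow (ξ : Ordinal.{0}) :
    ∃ l : List Ordinal.{0}, l.Pairwise (· ≥ ·) ∧ sumPow l = ξ := by
  induction ξ using WellFoundedLT.induction with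
  | ind ξ ih =>
    rcases eq_or_ne ξ 0 with rfl | hξ
    · exact ⟨[], List.Pairwise.nil, rfl⟩
    · obtain ⟨l, hl, hsum⟩ := ih _ (Ordinal.sub_omega0_opow_log_lt hξ)
      refine ⟨Ordinal.log Ordinal.omega0 ξ :: l, List.pairwise_cons.2 ⟨fun c hc => ?_, hl⟩, ?_⟩
      · refine Ordinal.le_log_of_opow_le Ordinal.one_lt_omega0 ?_
        exact (opow_le_sumPow hc).trans (hsum ▸ Ordinal.sub_le_self _ _)
      · rw [sumPow_cons, hsum]
        exact Ordinal.add_sub_cancel_of_le (Ordinal.opow_log_le_self _ hξ)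

theorem exists_sumPow_eq_add_one {l : List Ordinal.{0}} (hl : l.Pairwise (· ≥ ·))
    (h : (0 : Ordinal.{0}) ∈ l) : ∃ ζ, sumPow l = ζ + 1 := by
  induction l with
  | nil => simp at h
  | cons b l ih =>
    obtain ⟨hb, hl⟩ := List.pairwise_cons.1 hl
    rcases l with _ | ⟨c, l⟩
    · obtain rfl : 0 = b := by simpa using h
      exact ⟨0, by simp [sumPow_singleton]⟩
    · have h0 : (0 : Ordinal.{0}) ∈ c :: l := by
        rcases List.mem_cons.1 h with rfl | h
        · have : c = 0 := nonpos_iff_eq_zero.1 (hb c (by simp))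
          simp [this]
        · exact h
      obtain ⟨ζ, hζ⟩ := ih hl h0
      exact ⟨Ordinal.omega0 ^ b + ζ, by rw [sumPow_cons, hζ, add_assoc]⟩

theorem isSuccLimit_omega0_opow {b : Ordinal.{0}} (hb : b ≠ 0) :
    Order.IsSuccLimit (Ordinal.omega0 ^ b) :=
  Ordinal.isSuccLimit_opow_left Ordinal.isSuccLimit_omega0 hb

theorem isSuccLimit_sumPow {l : List Ordinal.{0}} (hne : l ≠ []) (h : ∀ b ∈ l, b ≠ 0) :
    Order.IsSuccLimit (sumPow l) := by
  induction l with
  | nil => exact absurd rfl hne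
  | cons b l ih =>
    rcases eq_or_ne l [] with rfl | hl
    · rw [sumPow_singleton]
      exact isSuccLimit_omega0_opow (h b (by simp))
    · rw [sumPow_cons]
      exact Ordinal.isSuccLimit_add _ (ih hl fun c hc => h c (by simp [hc]))

theorem not_isSuccLimit_add_one (ζ : Ordinal.{0}) : ¬ Order.IsSuccLimit (ζ + 1) :=
  Order.not_isSuccLimit_succ ζ

/-! ### Uniform families of finite sets -/

/-- The sets which become members of `A` by adding the smaller element `n`. -/
def tail (A : Set (Finset ℕ+)) (n : ℕ+) : Set (Finset ℕ+) :=
  {s | BlockLT {n} s ∧ insert n s ∈ A}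

/-- The members of `A` all of whose elements exceed `n`. -/
def restrict (A : Set (Finset ℕ+)) (n : ℕ+) : Set (Finset ℕ+) := {s | BlockLT {n} s ∧ s ∈ A}

/-- The unions of a member of `C` with a later member of `A`. -/
def join (C A : Set (Finset ℕ+)) : Set (Finset ℕ+) :=
  {u | ∃ c ∈ C, ∃ a ∈ A, BlockLT c a ∧ u = c ∪ a}

/-- `A`, considered on the integers greater than `m`, is a uniform family of rank `α`. -/
inductive Uniform : Ordinal.{0} → ℕ → Set (Finset ℕ+) → Prop
  | zero (m : ℕ) : Uniform 0 m {∅}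
  | step (α : Ordinal.{0}) (m : ℕ) (A : Set (Finset ℕ+)) (f : ℕ+ → Ordinal.{0}) (hA : ∅ ∉ A)
      (hlt : ∀ n : ℕ+, m < n → f n < α) (hlim : ∀ η < α, ∃ N : ℕ, ∀ n : ℕ+, N < n → η ≤ f n)
      (htail : ∀ n : ℕ+, m < n → Uniform (f n) n (tail A n)) : Uniform α m A

theorem Uniform.mono {α : Ordinal.{0}} {m m' : ℕ} {A : Set (Finset ℕ+)} (h : Uniform α m A)
    (hm : m ≤ m') : Uniform α m' A := by
  cases h with
  | zero => exact .zero m'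
  | step _ _ _ f hA hlt hlim htail =>
    exact .step α m' A f hA (fun n hn => hlt n (hm.trans_lt hn)) hlim
      fun n hn => htail n (hm.trans_lt hn)

theorem blockLT_singleton {n : ℕ+} {s : Finset ℕ+} : BlockLT {n} s ↔ ∀ x ∈ s, n < x := by
  simp [BlockLT]

theorem tail_restrict {A : Set (Finset ℕ+)} {n k : ℕ+} (h : n < k) :
    tail (restrict A n) k = tail A k := by
  ext s
  simp only [tail, restrict, blockLT_singleton, Set.mem_ofPred_eq]
  refine ⟨fun hs => ⟨hs.1, hs.2.2⟩, fun hs => ⟨hs.1, fun x hx => ?_, hs.2⟩⟩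
  rcases Finset.mem_insert.1 hx with rfl | hx
  exacts [h, h.trans (hs.1 x hx)]

theorem Uniform.restrict {α : Ordinal.{0}} {m : ℕ} {A : Set (Finset ℕ+)} (h : Uniform α m A)
    {n : ℕ+} (hn : m ≤ n) : Uniform α n (restrict A n) := by
  cases h with
  | zero =>
    have : BlockRamsey.restrict {∅} n = {∅} := by
      ext s
      simp only [BlockRamsey.restrict, Set.mem_ofPred_eq, Set.mem_singleton_iff]
      exact ⟨fun hs => hs.2, fun hs => ⟨by simp [hs, BlockLT], hs⟩⟩
    rw [this]
    exact .zero n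
  | step _ _ _ f hA hlt hlim htail =>
    refine .step α n _ f (fun h => hA h.2) (fun k hk => hlt k (hn.trans_lt hk)) hlim fun k hk => ?_
    rw [tail_restrict (PNat.coe_lt_coe n k |>.1 hk)]
    exact htail k (hn.trans_lt hk)

theorem join_empty_left (A : Set (Finset ℕ+)) : join {∅} A = A := by
  ext u
  simp [join, BlockLT]

theorem join_empty_right (A : Set (Finset ℕ+)) : join A {∅} = A := by
  ext u
  simp [join, BlockLT]

theorem blockLT_union_left {a b c : Finset ℕ+} : BlockLT (a ∪ b) c ↔ BlockLT a c ∧ BlockLT b c := by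
  simp only [BlockLT, Finset.mem_union]
  grind

theorem blockLT_union_right {a b c : Finset ℕ+} :
    BlockLT a (b ∪ c) ↔ BlockLT a b ∧ BlockLT a c := by
  simp only [BlockLT, Finset.mem_union]
  grind

theorem join_assoc (A B C : Set (Finset ℕ+)) : join (join A B) C = join A (join B C) := by
  ext u
  constructor
  · rintro ⟨_, ⟨a, ha, b, hb, hab, rfl⟩, c, hc, h, rfl⟩
    rw [blockLT_union_left] at h
    exact ⟨a, ha, _, ⟨b, hb, c, hc, h.2, rfl⟩, blockLT_union_right.2 ⟨hab, h.1⟩,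
      Finset.union_assoc a b c⟩
  · rintro ⟨a, ha, _, ⟨b, hb, c, hc, hbc, rfl⟩, h, rfl⟩
    rw [blockLT_union_right] at h
    exact ⟨_, ⟨a, ha, b, hb, h.1, rfl⟩, c, hc, blockLT_union_left.2 ⟨h.2, hbc⟩,
      (Finset.union_assoc a b c).symm⟩

/-- As `c` is non-empty and precedes `a`, the least element of `c ∪ a` is removed from `c`. The
restriction matters when `c = {n}`: the remaining `∅ < a` no longer says that `a` lies beyond `n`.
-/
theorem tail_join {C : Set (Finset ℕ+)} (hC : ∅ ∉ C) (A : Set (Finset ℕ+)) (n : ℕ+) :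
    tail (join C A) n = restrict (join (tail C n) A) n := by
  ext u
  constructor
  · rintro ⟨hnu, c, hc, a, ha, hca, hu⟩
    rw [blockLT_singleton] at hnu
    have hmin : ∀ x ∈ c ∪ a, x ≠ n → n < x := fun x hx hxn => by
      rw [← hu] at hx
      exact hnu x ((Finset.mem_insert.1 hx).resolve_left hxn)
    have hna : n ∉ a := by
      intro hna
      obtain ⟨y, hy⟩ := Finset.nonempty_iff_ne_empty.2 (fun h => hC (h ▸ hc) : c ≠ ∅)
      have hyn := hca y hy n hna
      exact hyn.asymm (hmin y (Finset.mem_union_left _ hy) hyn.ne)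
    have hnc : n ∈ c := by
      have : n ∈ c ∪ a := hu ▸ Finset.mem_insert_self n u
      exact (Finset.mem_union.1 this).resolve_right hna
    have hnu' : n ∉ u := fun h => lt_irrefl _ (hnu n h)
    refine ⟨blockLT_singleton.2 hnu, c.erase n, ⟨blockLT_singleton.2 fun x hx => ?_, ?_⟩, a, ha,
      hca.mono (Finset.erase_subset _ _) subset_rfl, ?_⟩
    · exact hmin x (Finset.mem_union_left _ (Finset.mem_of_mem_erase hx))
        (Finset.ne_of_mem_erase hx)
    · rwa [Finset.insert_erase hnc]
    · rw [← Finset.erase_insert hnu', hu, Finset.erase_union_distrib, Finset.erase_eq_of_notMem hna]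
  · rintro ⟨hnu, c, ⟨hnc, hc⟩, a, ha, hca, rfl⟩
    refine ⟨hnu, _, hc, a, ha, ?_, (Finset.insert_union n c a).symm⟩
    rw [Finset.insert_eq, blockLT_union_left]
    exact ⟨(blockLT_union_right.1 hnu).2, hca⟩

/-- The earlier sets, those of `C`, are consumed first when tails are taken, so their rank `γ` is
the right summand. -/
theorem Uniform.join {α γ : Ordinal.{0}} {m : ℕ} {C A : Set (Finset ℕ+)} (hC : Uniform γ m C)
    (hA : Uniform α m A) : Uniform (α + γ) m (join C A) := by
  induction hC with
  | zero m =>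
    rw [join_empty_left, add_zero]
    exact hA
  | step γ m C f hC hlt hlim htail ih =>
    refine .step _ m _ (fun n => α + f n) ?_ (fun n hn => by simpa using hlt n hn) ?_ ?_
    · rintro ⟨c, hc, a, -, -, hca⟩
      rw [eq_comm, Finset.union_eq_empty] at hca
      exact hC (hca.1 ▸ hc)
    · intro η hη
      rcases lt_or_ge η α with h | h
      · exact ⟨0, fun n _ => h.le.trans le_self_add⟩
      · rw [← Ordinal.add_sub_cancel_of_le h, add_lt_add_iff_left] at hη
        obtain ⟨N, hN⟩ := hlim _ hη
        refine ⟨N, fun n hn => ?_⟩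
        rw [← Ordinal.add_sub_cancel_of_le h]
        simpa using hN n hn
    · intro n hn
      rw [tail_join hC]
      exact (ih n hn (hA.mono hn.le)).restrict le_rfl

/-- The iterated joins of the families `S b` along a list, the last entry coming first. -/
def chain (S : Ordinal.{0} → Set (Finset ℕ+)) : List Ordinal.{0} → Set (Finset ℕ+)
  | [] => {∅}
  | b :: l => join (chain S l) (S b)

/-- Exposes the earliest factor, the one on which `tail` acts, instead of the latest. -/
theorem chain_replicate_succ (S : Ordinal.{0} → Set (Finset ℕ+)) (β : Ordinal.{0}) (k : ℕ) :
    chain S (List.replicate (k + 1) β) = join (S β) (chain S (List.replicate k β)) := by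
  induction k with
  | zero => simp [chain, join_empty_left, join_empty_right]
  | succ k ih =>
    rw [List.replicate_succ, chain, ih, join_assoc, ← chain, ← List.replicate_succ, ih]

theorem uniform_chain {S : Ordinal.{0} → Set (Finset ℕ+)} {l : List Ordinal.{0}}
    (h : ∀ b ∈ l, Uniform (Ordinal.omega0 ^ b) 0 (S b)) : Uniform (sumPow l) 0 (chain S l) := by
  induction l with
  | nil => exact .zero 0
  | cons b l ih =>
    rw [sumPow_cons]
    exact (ih fun c hc => h c (by simp [hc])).join (h b (by simp))

theorem mem_chain_ofFn {S : Ordinal.{0} → Set (Finset ℕ+)} {r : ℕ} {b : Fin r → Ordinal.{0}}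
    {u : Finset ℕ+} : u ∈ chain S (List.ofFn b) ↔ ∃ s : Fin r → Finset ℕ+,
      (∀ i j, i < j → BlockLT (s j) (s i)) ∧ (∀ i, s i ∈ S (b i)) ∧ u = Finset.univ.biUnion s := by
  induction r generalizing u with
  | zero => simp [chain]
  | succ r ih =>
    have hbi : ∀ s : Fin (r + 1) → Finset ℕ+,
        Finset.univ.biUnion s = Finset.univ.biUnion (fun i : Fin r => s i.succ) ∪ s 0 := by
      intro s
      ext x
      simp [Fin.exists_fin_succ, or_comm]
    rw [List.ofFn_succ, chain]
    constructor
    · rintro ⟨c, hc, a, ha, hca, rfl⟩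
      obtain ⟨s, hlt, hs, rfl⟩ := ih.1 hc
      refine ⟨Fin.cons a s, fun i j hij => ?_, fun i => ?_, by rw [hbi]; simp⟩
      · cases j using Fin.cases with
        | zero => exact absurd hij (Fin.not_lt_zero i)
        | succ j =>
          cases i using Fin.cases with
          | zero =>
            exact hca.mono (Finset.subset_biUnion_of_mem s (Finset.mem_univ j)) subset_rfl
          | succ i => exact hlt i j (Fin.succ_lt_succ_iff.1 hij)
      · cases i using Fin.cases with
        | zero => exact ha
        | succ i => exact hs i
    · rintro ⟨s, hlt, hs, rfl⟩
      refine ⟨_, ih.2 ⟨fun i => s i.succ, fun i j hij => hlt _ _ (Fin.succ_lt_succ_iff.2 hij),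
        fun i => hs _, rfl⟩, s 0, hs 0, fun x hx y hy => ?_, hbi s⟩
      obtain ⟨i, -, hx⟩ := Finset.mem_biUnion.1 hx
      exact hlt 0 i.succ (Fin.succ_pos i) x hx y hy

/-! ### The families `𝒜_ξ` are uniform of rank `ξ` -/

/-- The family `𝒜_ξ` as a set. -/
def schreierFamily (lam : Ordinal.{0} → ℕ+ → Ordinal.{0}) (ξ : Ordinal.{0}) : Set (Finset ℕ+) :=
  {s | Schreier lam ξ s}

section Inversion
variable {lam : Ordinal.{0} → ℕ+ → Ordinal.{0}}

theorem pairwise_ofFn_of_antitone {r : ℕ} {b : Fin r → Ordinal.{0}} (hb : Antitone b) :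
    (List.ofFn b).Pairwise (· ≥ ·) :=
  List.pairwise_ofFn.2 fun _ _ hij => hb hij.le

theorem isSuccLimit_sumPow_ofFn {r : ℕ} (hr : 2 ≤ r) {b : Fin r → Ordinal.{0}}
    (hpos : ∀ i, 0 < b i) : Order.IsSuccLimit (sumPow (List.ofFn b)) := by
  refine isSuccLimit_sumPow (fun h => ?_) fun c hc => ?_
  · have := congrArg List.length h
    simp at this
    omega
  · obtain ⟨i, rfl⟩ := (List.mem_ofFn' b c).1 hc
    exact (hpos i).ne'

theorem sumPow_ofFn_ne_opow {r : ℕ} (hr : 2 ≤ r) {b : Fin r → Ordinal.{0}} (hb : Antitone b)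
    (c : Ordinal.{0}) : Ordinal.omega0 ^ c ≠ sumPow (List.ofFn b) := by
  intro h
  rw [← sumPow_singleton] at h
  have := congrArg List.length
    (sumPow_injective (List.pairwise_singleton _ c) (pairwise_ofFn_of_antitone hb) h)
  simp at this
  omega

theorem schreier_zero_iff {s : Finset ℕ+} : Schreier lam 0 s ↔ s = ∅ := by
  refine ⟨fun h => ?_, fun h => h ▸ .zero⟩
  generalize hx : (0 : Ordinal.{0}) = x at h
  cases h with
  | zero => rfl
  | succ ζ => exact absurd hx.symm (by simp)
  | powSucc β => exact absurd hx.symm (Ordinal.opow_ne_zero _ Ordinal.omega0_ne_zero)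
  | powLimit l => exact absurd hx.symm (Ordinal.opow_ne_zero _ Ordinal.omega0_ne_zero)
  | normalForm r hr b hb hpos =>
    rw [sumPow_ofFn] at hx
    exact absurd hx.symm (isSuccLimit_sumPow_ofFn hr hpos).ne_bot

theorem schreier_add_one_iff {ζ : Ordinal.{0}} {s : Finset ℕ+} : Schreier lam (ζ + 1) s ↔
    ∃ (n : ℕ+) (t : Finset ℕ+), BlockLT {n} t ∧ Schreier lam ζ t ∧ s = insert n t := by
  refine ⟨fun h => ?_, fun ⟨n, t, hn, ht, hs⟩ => hs ▸ .succ ζ n t hn ht⟩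
  have hlim := not_isSuccLimit_add_one ζ
  generalize hx : ζ + 1 = x at h hlim
  cases h with
  | zero => exact absurd hx (by simp)
  | succ ζ' n t hn ht =>
    obtain rfl : ζ = ζ' := Order.succ_injective hx
    exact ⟨n, t, hn, ht, rfl⟩
  | powSucc β =>
    exact absurd (isSuccLimit_omega0_opow (by simp)) hlim
  | powLimit l hl => exact absurd (isSuccLimit_omega0_opow hl.ne_bot) hlim
  | normalForm r hr b hb hpos =>
    rw [sumPow_ofFn] at hlim
    exact absurd (isSuccLimit_sumPow_ofFn hr hpos) hlim

theorem schreier_powLimit_iff {l : Ordinal.{0}} (hl : Order.IsSuccLimit l) {s : Finset ℕ+} :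
    Schreier lam (Ordinal.omega0 ^ l) s ↔
      ∃ n, IsLeast (s : Set ℕ+) n ∧ Schreier lam (Ordinal.omega0 ^ (lam l n)) s := by
  refine ⟨fun h => ?_, fun ⟨n, hn, hs⟩ => .powLimit l hl n s hn hs⟩
  generalize hx : Ordinal.omega0 ^ l = x at h
  have hlim : Order.IsSuccLimit x := hx ▸ isSuccLimit_omega0_opow hl.ne_bot
  cases h with
  | zero => exact absurd rfl hlim.ne_bot
  | succ ζ' => exact absurd hlim (not_isSuccLimit_add_one ζ')
  | powSucc β =>
    rw [Ordinal.opow_right_inj Ordinal.one_lt_omega0] at hx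
    exact absurd (hx ▸ hl) (not_isSuccLimit_add_one β)
  | powLimit l' hl' n _ hn hs =>
    rw [Ordinal.opow_right_inj Ordinal.one_lt_omega0] at hx
    exact ⟨n, hn, hx ▸ hs⟩
  | normalForm r hr b hb hpos =>
    rw [sumPow_ofFn] at hx
    exact absurd hx (sumPow_ofFn_ne_opow hr hb l)

theorem schreier_sumPow_iff {l : List Ordinal.{0}} (hl : l.Pairwise (· ≥ ·))
    (hpos : ∀ b ∈ l, b ≠ 0) (hlen : 2 ≤ l.length) {s : Finset ℕ+} :
    Schreier lam (sumPow l) s ↔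
      s ∈ chain (fun b => schreierFamily lam (Ordinal.omega0 ^ b)) l := by
  constructor
  · intro h
    generalize hx : sumPow l = x at h
    have hlim : Order.IsSuccLimit x := hx ▸ isSuccLimit_sumPow (by rintro rfl; simp at hlen) hpos
    have hne : ∀ c : Ordinal.{0}, sumPow l ≠ Ordinal.omega0 ^ c := by
      intro c hc
      rw [← sumPow_singleton] at hc
      have := sumPow_injective hl (List.pairwise_singleton _ c) hc
      simp [this] at hlen
    cases h with
    | zero => exact absurd rfl hlim.ne_bot
    | succ ζ' => exact absurd hlim (not_isSuccLimit_add_one ζ')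
    | powSucc β => exact absurd hx (hne _)
    | powLimit l' => exact absurd hx (hne _)
    | normalForm r hr b hb _ s hlt hs =>
      rw [sumPow_ofFn] at hx
      rw [sumPow_injective hl (pairwise_ofFn_of_antitone hb) hx]
      exact mem_chain_ofFn.2 ⟨s, hlt, hs, rfl⟩
  · intro h
    have hget : List.ofFn l.get = l := List.ofFn_get l
    rw [← hget] at h
    obtain ⟨t, hlt, hs, rfl⟩ := mem_chain_ofFn.1 h
    rw [← congrArg sumPow hget, ← sumPow_ofFn]
    refine .normalForm l.length hlen l.get (fun i j hij => ?_)
      (fun i => pos_iff_ne_zero.2 (hpos _ (List.get_mem l i))) t hlt hs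
    rcases hij.eq_or_lt with rfl | hij
    · exact le_rfl
    · exact List.pairwise_iff_get.1 hl i j hij

/-- `hβ` excludes empty pieces, so the minimum of the union lies in the earliest one. The rule lists
pieces upwards and `chain` downwards, whence `Fin.rev`. -/
theorem schreier_powSucc_iff {β : Ordinal.{0}} (hβ : ¬ Schreier lam (Ordinal.omega0 ^ β) ∅)
    {u : Finset ℕ+} : Schreier lam (Ordinal.omega0 ^ (β + 1)) u ↔
      ∃ n : ℕ+, IsLeast (u : Set ℕ+) n ∧
        u ∈ chain (fun b => schreierFamily lam (Ordinal.omega0 ^ b)) (List.replicate n β) := by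
  constructor
  · intro h
    generalize hx : Ordinal.omega0 ^ (β + 1) = x at h
    have hlim : Order.IsSuccLimit x := hx ▸ isSuccLimit_omega0_opow (by simp)
    cases h with
    | zero => exact absurd rfl hlim.ne_bot
    | succ ζ' => exact absurd hlim (not_isSuccLimit_add_one ζ')
    | powSucc β' n s hmin hlt hs =>
      rw [Ordinal.opow_right_inj Ordinal.one_lt_omega0] at hx
      obtain rfl : β = β' := Order.succ_injective hx
      refine ⟨n, ⟨Finset.mem_biUnion.2 ⟨_, Finset.mem_univ _, hmin.1⟩, fun x hx => ?_⟩, ?_⟩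
      · obtain ⟨i, -, hxi⟩ := Finset.mem_biUnion.1 hx
        rcases Nat.eq_zero_or_pos i with hi | hi
        · obtain rfl : i = ⟨0, n.pos⟩ := Fin.ext hi
          exact hmin.2 hxi
        · exact (hlt ⟨0, n.pos⟩ i hi n hmin.1 x hxi).le
      · rw [← List.ofFn_const, mem_chain_ofFn]
        refine ⟨fun i => s i.rev, fun i j hij => hlt _ _ (Fin.rev_lt_rev.2 hij),
          fun i => hs _, ?_⟩
        ext x
        simp only [Finset.mem_biUnion, Finset.mem_univ, true_and]
        exact (Fin.rev_surjective.exists (p := fun i => x ∈ s i))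
    | powLimit l hl =>
      rw [Ordinal.opow_right_inj Ordinal.one_lt_omega0] at hx
      exact absurd (hx ▸ hl) (not_isSuccLimit_add_one β)
    | normalForm r hr b hb hpos =>
      rw [sumPow_ofFn] at hx
      exact absurd hx (sumPow_ofFn_ne_opow hr hb _)
  · rintro ⟨n, hn, hu⟩
    rw [← List.ofFn_const, mem_chain_ofFn] at hu
    obtain ⟨s, hlt, hs, rfl⟩ := hu
    have hrev : Finset.univ.biUnion s = Finset.univ.biUnion fun i : Fin n => s i.rev := by
      ext x
      simp only [Finset.mem_biUnion, Finset.mem_univ, true_and]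
      exact (Fin.rev_surjective.exists (p := fun i => x ∈ s i))
    rw [hrev]
    refine .powSucc β n _ ⟨?_, fun x hx => ?_⟩ (fun i j hij => hlt _ _ (Fin.rev_lt_rev.2 hij))
      fun i => hs _
    · obtain ⟨i, -, hni⟩ := Finset.mem_biUnion.1 hn.1
      rcases (Fin.le_def.2 (Nat.le_sub_one_of_lt i.2) : i ≤ Fin.rev ⟨0, n.pos⟩).eq_or_lt with h | h
      · exact h ▸ hni
      · have hne : (s (Fin.rev ⟨0, n.pos⟩)).Nonempty :=
          Finset.nonempty_iff_ne_empty.2 fun h => hβ (h ▸ hs _)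
        obtain ⟨y, hy⟩ := hne
        have h₁ := hlt _ _ h y hy n hni
        exact absurd (hn.2 (Finset.mem_biUnion.2 ⟨_, Finset.mem_univ _, hy⟩)) h₁.not_ge
    · exact hn.2 (Finset.mem_biUnion.2 ⟨_, Finset.mem_univ _, hx⟩)

end Inversion

theorem isLeast_insert {n : ℕ+} {s : Finset ℕ+} (h : BlockLT {n} s) :
    IsLeast ((insert n s : Finset ℕ+) : Set ℕ+) n := by
  refine ⟨Finset.mem_insert_self n s, fun x hx => ?_⟩
  rcases Finset.mem_insert.1 hx with rfl | hx
  exacts [le_rfl, (blockLT_singleton.1 h x hx).le]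

theorem tail_of_isLeast {A : Set (Finset ℕ+)} {C : ℕ+ → Set (Finset ℕ+)}
    (h : ∀ u, u ∈ A ↔ ∃ n, IsLeast (u : Set ℕ+) n ∧ u ∈ C n) (n : ℕ+) :
    tail A n = tail (C n) n := by
  ext s
  simp only [tail, Set.mem_ofPred_eq]
  refine and_congr_right fun hs => ?_
  rw [h]
  refine ⟨fun ⟨k, hk, hC⟩ => ?_, fun hC => ⟨n, isLeast_insert hs, hC⟩⟩
  rwa [hk.unique (isLeast_insert hs)] at hC

theorem Uniform.exists_tail {α : Ordinal.{0}} (hα : α ≠ 0) {A : Set (Finset ℕ+)}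
    (h : Uniform α 0 A) : ∅ ∉ A ∧ ∀ n : ℕ+, ∃ γ < α, Uniform γ n (tail A n) := by
  cases h with
  | zero => exact absurd rfl hα
  | step _ _ _ f hA hlt _ htail => exact ⟨hA, fun n => ⟨f n, hlt n n.pos, htail n n.pos⟩⟩

/-- A member with minimum `n` consists of `n` pieces. Removing `n` leaves a rank below `ω ^ β` in
the first piece, while the other `n - 1` pieces contribute `ω ^ β * (n - 1)`. -/
theorem exists_uniform_tail_powSucc {lam : Ordinal.{0} → ℕ+ → Ordinal.{0}} {β : Ordinal.{0}}
    (h : Uniform (Ordinal.omega0 ^ β) 0 (schreierFamily lam (Ordinal.omega0 ^ β))) (n : ℕ+) :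
    ∃ γ, Ordinal.omega0 ^ β * ((n : ℕ) - 1 : ℕ) ≤ γ ∧ γ < Ordinal.omega0 ^ (β + 1) ∧
      Uniform γ n (tail (schreierFamily lam (Ordinal.omega0 ^ (β + 1))) n) := by
  obtain ⟨hne, htail⟩ := h.exists_tail (Ordinal.opow_ne_zero β Ordinal.omega0_ne_zero)
  obtain ⟨γ, hγ, hu⟩ := htail n
  refine ⟨Ordinal.omega0 ^ β * ((n : ℕ) - 1 : ℕ) + γ, le_self_add, ?_, ?_⟩
  · refine Ordinal.isPrincipal_add_omega0_opow (β + 1) ?_ (hγ.trans ?_)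
    · exact Ordinal.opow_mul_lt_opow (Ordinal.natCast_lt_omega0 _) (Order.lt_add_one_iff.2 le_rfl)
    · exact (Ordinal.opow_lt_opow_iff_right Ordinal.one_lt_omega0).2
        (Order.lt_add_one_iff.2 le_rfl)
  · have hset : tail (schreierFamily lam (Ordinal.omega0 ^ (β + 1))) n =
        tail (join (schreierFamily lam (Ordinal.omega0 ^ β))
          (chain (fun b => schreierFamily lam (Ordinal.omega0 ^ b))
            (List.replicate ((n : ℕ) - 1) β))) n := by
      rw [← chain_replicate_succ (fun b => schreierFamily lam (Ordinal.omega0 ^ b)),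
        Nat.sub_add_cancel n.pos]
      exact tail_of_isLeast (A := schreierFamily lam _) (fun u => schreier_powSucc_iff hne) n
    rw [hset, tail_join hne]
    refine (Uniform.join hu (Uniform.mono ?_ (Nat.zero_le _))).restrict le_rfl
    have hsum : sumPow (List.replicate ((n : ℕ) - 1) β) =
        Ordinal.omega0 ^ β * ((n : ℕ) - 1 : ℕ) := by
      rw [sumPow, List.map_replicate, List.sum_replicate, Ordinal.nsmul_eq_mul]
    rw [← hsum]
    exact uniform_chain fun b hb => (List.eq_of_mem_replicate hb) ▸ h

theorem uniform_schreierFamily {lam : Ordinal.{0} → ℕ+ → Ordinal.{0}} (hlam : IsLadderSystem lam)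
    (ξ : Ordinal.{0}) (hξ : ξ < Ordinal.omega 1) : Uniform ξ 0 (schreierFamily lam ξ) := by
  induction ξ using WellFoundedLT.induction with
  | ind ξ ih =>
  have ih' : ∀ ζ < ξ, Uniform ζ 0 (schreierFamily lam ζ) := fun ζ hζ => ih ζ hζ (hζ.trans hξ)
  have hpow : ∀ {b c : Ordinal.{0}}, b < c → Ordinal.omega0 ^ b < Ordinal.omega0 ^ c :=
    fun h => (Ordinal.opow_lt_opow_iff_right Ordinal.one_lt_omega0).2 h
  rcases Ordinal.zero_or_succ_or_isSuccLimit ξ with rfl | ⟨ζ, hsucc⟩ | hlim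
  · have : schreierFamily lam 0 = {∅} := by
      ext s
      exact schreier_zero_iff
    rw [this]
    exact .zero 0
  · obtain rfl : ξ = ζ + 1 := hsucc.symm
    have hζ : ζ < ζ + 1 := Order.lt_add_one_iff.2 le_rfl
    refine .step _ 0 _ (fun _ => ζ) (fun h => ?_) (fun _ _ => hζ)
      (fun η hη => ⟨0, fun _ _ => Order.lt_add_one_iff.1 hη⟩) fun n hn => ?_
    · obtain ⟨n, t, -, -, h⟩ := schreier_add_one_iff.1 h
      exact absurd h.symm (Finset.insert_ne_empty n t)
    · have : tail (schreierFamily lam (ζ + 1)) n = restrict (schreierFamily lam ζ) n := by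
        ext s
        refine and_congr_right fun hs => ?_
        refine ⟨fun h => ?_, fun h => .succ ζ n s hs h⟩
        obtain ⟨k, t, hk, ht, he⟩ := schreier_add_one_iff.1 h
        have hnk : n = k := (isLeast_insert hs).unique (he ▸ isLeast_insert hk)
        subst hnk
        have hns : n ∉ s := fun h => lt_irrefl _ (blockLT_singleton.1 hs n h)
        have hnt : n ∉ t := fun h => lt_irrefl _ (blockLT_singleton.1 hk n h)
        rw [← Finset.erase_insert hns, he, Finset.erase_insert hnt]
        exact ht
      rw [this]
      exact (ih' ζ hζ).restrict (Nat.zero_le _)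
  · obtain ⟨l, hl, hsum⟩ := exists_sumPow ξ
    have hpos : ∀ b ∈ l, b ≠ 0 := by
      rintro b hb rfl
      obtain ⟨ζ, hζ⟩ := exists_sumPow_eq_add_one hl hb
      exact not_isSuccLimit_add_one ζ (hζ ▸ hsum ▸ hlim)
    rcases l with _ | ⟨c, _ | ⟨c', l⟩⟩
    · exact absurd hsum.symm hlim.ne_bot
    · rw [sumPow_singleton] at hsum
      subst hsum
      have hc : c < Ordinal.omega 1 :=
        (Ordinal.right_le_opow c Ordinal.one_lt_omega0).trans_lt hξ
      rcases Ordinal.zero_or_succ_or_isSuccLimit c with rfl | ⟨β, hsucc⟩ | hclim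
      · exact absurd rfl (hpos 0 (by simp))
      · obtain rfl : c = β + 1 := hsucc.symm
        have hβ := ih' _ (hpow (Order.lt_add_one_iff.2 le_rfl : β < β + 1))
        choose f hle hlt hu using exists_uniform_tail_powSucc hβ
        refine .step _ 0 _ f (fun h => ?_) (fun n _ => hlt n) (fun η hη => ?_) fun n _ => hu n
        · obtain ⟨n, hn, -⟩ := (schreier_powSucc_iff
            (hβ.exists_tail (Ordinal.opow_ne_zero β Ordinal.omega0_ne_zero)).1).1 h
          exact Finset.notMem_empty n hn.1
        · obtain ⟨N, hN⟩ := Ordinal.lt_omega0_opow_succ.1 hη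
          -- Here `η < ω ^ β * N`, and `n > N` gives `N ≤ n - 1`.
          refine ⟨N, fun n hn => hN.le.trans (le_trans ?_ (hle n))⟩
          exact mul_le_mul_right (Nat.cast_le.2 (Nat.le_sub_one_of_lt hn)) _
      · obtain ⟨hmono, hsucc, hlt, hlub⟩ := hlam c hclim hc
        choose b hb using hsucc
        have htail : ∀ n, tail (schreierFamily lam (Ordinal.omega0 ^ c)) n =
            tail (schreierFamily lam (Ordinal.omega0 ^ (b n + 1))) n := fun n => by
          rw [← hb n]
          exact tail_of_isLeast (C := fun n => schreierFamily lam (Ordinal.omega0 ^ lam c n))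
            (fun u => schreier_powLimit_iff hclim) n
        have hbc : ∀ n, b n + 1 < c := fun n => hb n ▸ hlt n
        have huni : ∀ n, Uniform (Ordinal.omega0 ^ b n) 0
            (schreierFamily lam (Ordinal.omega0 ^ b n)) := fun n =>
          ih' _ (hpow ((Order.lt_add_one_iff.2 le_rfl).trans (hbc n)))
        choose f hle hflt hu using fun n => exists_uniform_tail_powSucc (huni n) n
        refine .step _ 0 _ f (fun h => ?_) (fun n _ => (hflt n).trans (hpow (hbc n)))
          (fun η hη => ?_) fun n _ => htail n ▸ hu n
        · obtain ⟨n, hn, -⟩ := (schreier_powLimit_iff hclim).1 h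
          exact Finset.notMem_empty n hn.1
        · obtain ⟨δ, hδ, hηδ⟩ := (Ordinal.lt_opow_of_isSuccLimit Ordinal.omega0_ne_zero hclim).1 hη
          obtain ⟨_, ⟨N, rfl⟩, hN⟩ := (lt_isLUB_iff hlub).1 hδ
          -- The ladder term is `b n + 1`, so the tail has rank at least `ω ^ b n * (n - 1)`; `n >
          -- 1` makes the factor at least `1`.
          refine ⟨max N 1, fun n hn => ?_⟩
          have hNn : N ≤ n := PNat.coe_le_coe N n |>.1 ((le_max_left _ _).trans hn.le)
          have hδb : δ ≤ b n := by
            have := hN.trans_le (hmono.monotone hNn)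
            rw [hb] at this
            exact Order.lt_add_one_iff.1 this
          have h1 : 1 ≤ (n : ℕ) - 1 := Nat.le_sub_one_of_lt ((le_max_right _ _).trans_lt hn)
          calc η ≤ Ordinal.omega0 ^ δ := hηδ.le
            _ ≤ Ordinal.omega0 ^ b n := Ordinal.opow_le_opow_right Ordinal.omega0_pos hδb
            _ = Ordinal.omega0 ^ b n * (1 : ℕ) := by simp
            _ ≤ Ordinal.omega0 ^ b n * ((n : ℕ) - 1 : ℕ) := mul_le_mul_right (Nat.cast_le.2 h1) _
            _ ≤ f n := hle n
    · have hset : schreierFamily lam ξ = chain (fun b => schreierFamily lam (Ordinal.omega0 ^ b))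
          (c :: c' :: l) := by
        ext s
        rw [← hsum]
        exact schreier_sumPow_iff hl hpos (by simp)
      rw [hset, ← hsum]
      -- With at least two positive summands, each single power is strictly below `ξ`.
      refine uniform_chain fun b hb => ih' _ ?_
      have hbc : b ≤ c := by
        rcases List.mem_cons.1 hb with rfl | hb
        exacts [le_rfl, (List.pairwise_cons.1 hl).1 b hb]
      refine (Ordinal.opow_le_opow_right Ordinal.omega0_pos hbc).trans_lt ?_
      rw [← hsum, sumPow_cons]
      refine lt_add_of_pos_right _ ?_
      exact (Ordinal.opow_pos c' Ordinal.omega0_pos).trans_le (opow_le_sumPow (by simp))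

/-! ### From uniform families to ranked fronts -/

theorem image_blockMin_eq_empty {c : Finset (Finset ℕ+)} : c.image blockMin = ∅ ↔ c = ∅ :=
  Finset.image_eq_empty

/-- Appending a block `t` replaces `A` by `tail A (blockMin t)`, so the tree of collections inherits
the ranks of the tree of minima. -/
theorem Uniform.blockRank {B : Set (Finset (Finset ℕ+))} {α : Ordinal.{0}}
    {m : ℕ} {A : Set (Finset ℕ+)} (h : Uniform α m A) {s : Finset (Finset ℕ+)}
    (hm : ∀ t, t.Nonempty → Beyond s t → m < (blockMin t : ℕ))
    (hsB : ∀ c ∈ FinColl, (∀ u ∈ c, Beyond s u) → (s ∪ c ∈ B ↔ c.image blockMin ∈ A)) :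
    BlockRank B α s := by
  have h₀ := hsB ∅ empty_mem_FinColl (by simp)
  rw [Finset.union_empty, Finset.image_empty] at h₀
  induction h generalizing s with
  | zero =>
    refine .leaf s (h₀.2 rfl) fun c hc hne hsc => ?_
    rw [hsB c hc hsc, Set.mem_singleton_iff, image_blockMin_eq_empty]
    exact hne.ne_empty
  | step α m A f hA hlt hlim htail ih =>
    refine .node α s (fun t => f (blockMin t)) (fun h => hA (h₀.1 h))
      (fun t ht hst => hlt _ (hm t ht hst)) (fun η hη => ?_) fun t ht hst => ?_
    · obtain ⟨N, hN⟩ := hlim η hη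
      exact ⟨N, fun t ht hta => hN _ ((above_iff_blockMin ht).1 hta)⟩
    · have hcond : ∀ c ∈ FinColl, (∀ u ∈ c, Beyond (insert t s) u) →
          (insert t s ∪ c ∈ B ↔ c.image blockMin ∈ tail A (blockMin t)) := by
        intro c hc hsc
        have htc : ∀ u ∈ c, BlockLT t u := fun u hu => hsc u hu t (by simp)
        have hc' : insert t c ∈ FinColl := by
          refine ⟨fun u hu => ?_, fun u hu v hv huv => ?_⟩
          · rcases Finset.mem_insert.1 hu with rfl | hu
            exacts [ht, hc.1 u hu]
          · rcases Finset.mem_insert.1 hu with hut | huc <;>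
              rcases Finset.mem_insert.1 hv with hvt | hvc
            · exact absurd (hut.trans hvt.symm) huv
            · exact Or.inl (hut ▸ htc v hvc)
            · exact Or.inr (hvt ▸ htc u huc)
            · exact hc.2 u huc v hvc huv
        rw [Finset.insert_union, ← Finset.union_insert, hsB _ hc' fun u hu => ?_,
          Finset.image_insert]
        · refine ⟨fun h => ⟨blockLT_singleton.2 fun x hx => ?_, h⟩, fun h => h.2⟩
          obtain ⟨u, hu, rfl⟩ := Finset.mem_image.1 hx
          exact (htc u hu).blockMin_lt ht (hc.1 u hu)
        · rcases Finset.mem_insert.1 hu with rfl | hu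
          · exact hst
          · exact fun v hv => hsc u hu v (by simp [hv])
      have h₀' := hcond ∅ empty_mem_FinColl (by simp)
      rw [Finset.union_empty, Finset.image_empty] at h₀'
      exact ih (blockMin t) (hm t ht hst)
        (fun u hu htu => (htu t (by simp)).blockMin_lt ht hu) hcond h₀'

theorem blockRank_blockSchreier {lam : Ordinal.{0} → ℕ+ → Ordinal.{0}}
    (hlam : IsLadderSystem lam) {ξ : Ordinal.{0}} (hξ : ξ < Ordinal.omega 1) :
    BlockRank (BlockSchreier lam ξ) ξ ∅ := by
  refine (uniform_schreierFamily hlam ξ hξ).blockRank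
    (fun t _ _ => (blockMin t).pos) fun c hc _ => ?_
  rw [Finset.empty_union]
  exact ⟨fun h => h.2, fun h => ⟨hc, h⟩⟩

/-! ### Families bounded by the first minimum -/

/-- The disjoint collections `s` whose cardinality `k` satisfies `r k n` for all elements `n` of
members of `s`. -/
def boundedFamily (r : ℕ → ℕ → Prop) : Set (Finset (Finset ℕ+)) :=
  {s | s ∈ FinColl ∧ ∀ u ∈ s, ∀ x ∈ u, r s.card x}

/-- Each member of `t` contains a block of `s`, and disjoint members contain different ones. -/
theorem card_le_of_subset_FU {s t : Finset (Finset ℕ+)} (ht : t ∈ FinColl)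
    (h : ∀ u ∈ t, u ∈ FU (s : Set (Finset ℕ+))) : t.card ≤ s.card := by
  have hf : ∀ u : Finset ℕ+, ∃ v : Finset ℕ+, u ∈ t → v ∈ s ∧ v.Nonempty ∧ v ⊆ u := by
    intro u
    by_cases hu : u ∈ t
    · obtain ⟨J, -, hJs, rfl⟩ := h u hu
      obtain ⟨x, hx⟩ := ht.1 _ hu
      obtain ⟨v, hv, hxv⟩ := Finset.mem_biUnion.1 hx
      exact ⟨v, fun _ => ⟨hJs v hv, ⟨x, hxv⟩, Finset.subset_biUnion_of_mem id hv⟩⟩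
    · exact ⟨∅, fun h => absurd h hu⟩
  choose f hf using hf
  refine Finset.card_le_card_of_injOn f (fun u hu => (hf u hu).1) fun u hu v hv huv => ?_
  by_contra hne
  obtain ⟨-, ⟨x, hx⟩, hxu⟩ := hf u hu
  have hxv : x ∈ v := (hf v hv).2.2 (huv ▸ hx)
  rcases ht.2 u hu v hv hne with h | h
  exacts [lt_irrefl _ (h x (hxu hx) x hxv), lt_irrefl _ (h x hxv x (hxu hx))]

theorem isHereditary_boundedFamily {r : ℕ → ℕ → Prop} (hr : ∀ k k' n, k ≤ k' → r k' n → r k n) :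
    IsHereditary (boundedFamily r) := by
  refine IsDownClosed.isHereditary (fun s hs t ht hts => ⟨ht, fun u hu x hx => ?_⟩)
    ⟨empty_mem_FinColl, by simp⟩ fun s hs => hs.1
  obtain ⟨J, -, hJ, rfl⟩ := hts u hu
  obtain ⟨v, hv, hxv⟩ := Finset.mem_biUnion.1 hx
  exact hr _ _ _ (card_le_of_subset_FU ht hts) (hs.2 v (hJ v hv) x hxv)

theorem card_image_seq (D : InfColl) (n : ℕ) : ((Finset.range n).image D.seq).card = n := by
  rw [Finset.card_image_of_injective, Finset.card_range]
  intro i j hij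
  by_contra hne
  rcases lt_or_gt_of_ne hne with h | h
  exacts [(D.lt h).ne (D.nonempty i) hij, (D.lt h).ne (D.nonempty j) hij.symm]

theorem pointwiseClosed_boundedFamily {r : ℕ → ℕ → Prop}
    (hr : ∀ k k' n, k ≤ k' → r k' n → r k n) (hle : ∀ k n, r k n → k ≤ n) (D : InfColl) :
    PointwiseClosed (boundedFamily r ∩ FinCollOf D) := by
  by_contra h
  obtain ⟨D₁, -, hD₁⟩ := (isHereditary_boundedFamily hr).isDownClosed.exists_of_not_closed h
  obtain ⟨x, hx⟩ := D₁.nonempty 0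
  have hmem : (Finset.range (x + 1)).image D₁.seq ∈ FinCollOf D₁ :=
    Below.finite_subset (InfColl.Below.refl D₁) fun u hu => by
      obtain ⟨i, -, rfl⟩ := Finset.mem_image.1 hu
      exact ⟨i, rfl⟩
  have := hle _ _ ((hD₁ hmem).2 (D₁.seq 0) (Finset.mem_image.2 ⟨0, by simp, rfl⟩) x hx)
  rw [card_image_seq] at this
  omega

theorem card_add_le_of_mem_iterDeriv {D : InfColl} {r : ℕ → ℕ → Prop} (k : ℕ)
    {s : Finset (Finset ℕ+)} (hs : s ∈ iterDeriv D (boundedFamily r) k) :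
    ∀ u ∈ s, ∀ x ∈ u, r (s.card + k) x := by
  induction k generalizing s with
  | zero =>
    rw [Nat.cast_zero, iterDeriv_zero] at hs
    exact hs.2
  | succ k ih =>
    rw [Nat.cast_add_one, iterDeriv_add_one] at hs
    obtain ⟨t, ht, hst, hts⟩ := exists_insert_mem_of_mem_strongDeriv hs
    intro u hu x hx
    have := ih hts u (by simp [hu]) x hx
    rwa [Finset.card_insert_of_notMem (hst.notMem (InfColl.nonempty_of_mem_FU ht)),
      add_right_comm] at this

theorem mem_iterDeriv_boundedFamily {D : InfColl} {r : ℕ → ℕ → Prop}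
    (hr : ∀ k k' n, k ≤ k' → r k' n → r k n) (hr' : ∀ k n n', n ≤ n' → r k n → r k n')
    (hfar : ∀ k, ∃ n, r k n) (k : ℕ) {s : Finset (Finset ℕ+)} (hsD : s ∈ FinCollOf D)
    (hs : ∀ u ∈ s, ∀ x ∈ u, r (s.card + k) x) : s ∈ iterDeriv D (boundedFamily r) k := by
  induction k generalizing s with
  | zero =>
    rw [Nat.cast_zero, iterDeriv_zero]
    exact ⟨hsD.1, hs⟩
  | succ k ih =>
    rw [Nat.cast_add_one, iterDeriv_add_one, mem_strongDeriv_iff]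
    obtain ⟨M, hM⟩ := exists_bound s
    obtain ⟨N, hN⟩ := hfar (s.card + (k + 1))
    refine ⟨ih hsD fun u hu x hx => hr _ _ _ (by omega) (hs u hu x hx), hsD, max M N,
      fun t ht hta => ?_⟩
    have hst := (hta.mono (le_max_left _ _)).beyond hM
    refine ih (insert_mem_FinCollOf hsD ht hst) fun u hu x hx => ?_
    rw [Finset.card_insert_of_notMem (hst.notMem (InfColl.nonempty_of_mem_FU ht)),
      add_assoc, add_comm 1 k]
    rcases Finset.mem_insert.1 hu with rfl | hu
    · exact hr' _ _ _ (hta.mono (le_max_right _ _) x hx).le hN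
    · exact hs u hu x hx

/-- Each derivation reserves room for one more block. `∅` survives every finite order because `r k`
holds far out, but once a block is present its elements bound the room left. -/
theorem strongIndex_boundedFamily {r : ℕ → ℕ → Prop}
    (hr : ∀ k k' n, k ≤ k' → r k' n → r k n) (hr' : ∀ k n n', n ≤ n' → r k n → r k n')
    (hfar : ∀ k, ∃ n, r k n) (hle : ∀ k n, r k n → k ≤ n) (D : InfColl) :
    strongIndex D (boundedFamily r) = Ordinal.omega0 + 1 := by
  have hF := (isHereditary_boundedFamily hr).isDownClosed
  have hempty : iterDeriv D (boundedFamily r) (Ordinal.omega0 + 1) = ∅ := by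
    by_contra hne
    have h := (hF.iterDeriv D _).empty_mem (Set.nonempty_iff_ne_empty.2 hne)
    rw [iterDeriv_add_one] at h
    obtain ⟨t, ht, -, hts⟩ := exists_insert_mem_of_mem_strongDeriv h
    obtain ⟨x, hx⟩ := InfColl.nonempty_of_mem_FU ht
    -- The order `x` is an element of the block itself, which yields `1 + x ≤ x`.
    have := hle _ _ (card_add_le_of_mem_iterDeriv x
      (iterDeriv_antitone D _ (Ordinal.natCast_lt_omega0 _).le hts) t (by simp) x hx)
    simp at this
  refine le_antisymm (strongIndex_le hempty) (Order.add_one_le_of_lt ?_)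
  refine (lt_strongIndex_iff hF ⟨_, hempty⟩).2 ((mem_iterDeriv_limit
    Ordinal.isSuccLimit_omega0).2 fun β hβ => ?_)
  obtain ⟨k, rfl⟩ := Ordinal.lt_omega0.1 hβ
  exact mem_iterDeriv_boundedFamily hr hr' hfar k (empty_mem_FinCollOf D) (by simp)

theorem supIndex_boundedFamily {r : ℕ → ℕ → Prop}
    (hr : ∀ k k' n, k ≤ k' → r k' n → r k n) (hr' : ∀ k n n', n ≤ n' → r k n → r k n')
    (hfar : ∀ k, ∃ n, r k n) (hle : ∀ k n, r k n → k ≤ n) (D : InfColl) :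
    supIndex D (boundedFamily r) = Ordinal.omega0 + 1 := by
  have h := fun D₁ => strongIndex_boundedFamily hr hr' hfar hle D₁
  refine le_antisymm (supIndex_le fun D₁ _ => (h D₁).le) ?_
  rw [← h D]
  exact strongIndex_le_supIndex (fun D₁ _ => (h D₁).le) (InfColl.Below.refl D)

theorem card_of_schreier_omega0 {lam : Ordinal.{0} → ℕ+ → Ordinal.{0}} {s : Finset ℕ+}
    (hs : Schreier lam Ordinal.omega0 s) : ∃ n : ℕ+, IsLeast (s : Set ℕ+) n ∧ s.card = n := by
  have hone : ∀ t, Schreier lam (Ordinal.omega0 ^ (0 : Ordinal.{0})) t → t.card = 1 := by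
    intro t ht
    rw [Ordinal.opow_zero, ← zero_add 1] at ht
    obtain ⟨n, s, -, hs, rfl⟩ := schreier_add_one_iff.1 ht
    rw [schreier_zero_iff.1 hs]
    rfl
  rw [← Ordinal.opow_one Ordinal.omega0, ← zero_add 1] at hs
  obtain ⟨n, hn, hu⟩ := (schreier_powSucc_iff fun h => by simpa using hone ∅ h).1 hs
  refine ⟨n, hn, ?_⟩
  rw [← List.ofFn_const, mem_chain_ofFn] at hu
  obtain ⟨t, hlt, ht, rfl⟩ := hu
  have hdisj : ∀ i j, i < j → Disjoint (t i) (t j) := fun i j hij =>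
    Finset.disjoint_left.2 fun x hxi hxj => lt_irrefl _ (hlt i j hij x hxj x hxi)
  rw [Finset.card_biUnion fun i _ j _ hij => ?_]
  · rw [Finset.sum_congr rfl fun i _ => hone (t i) (ht i)]
    simp
  · rcases lt_or_gt_of_ne hij with h | h
    exacts [hdisj i j h, (hdisj j i h).symm]

theorem exists_card_of_mem_blockSchreier {lam : Ordinal.{0} → ℕ+ → Ordinal.{0}}
    {s : Finset (Finset ℕ+)} (hs : s ∈ BlockSchreier lam Ordinal.omega0) :
    ∃ n : ℕ+, s.card = n ∧ (∃ u ∈ s, n ∈ u) ∧ ∀ u ∈ s, ∀ x ∈ u, n ≤ x := by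
  obtain ⟨hsF, hs⟩ := hs
  obtain ⟨n, hn, hcard⟩ := card_of_schreier_omega0 hs
  refine ⟨n, ?_, ?_, fun u hu x hx => ?_⟩
  · rw [← hcard, Finset.card_image_of_injOn]
    intro u hu v hv huv
    by_contra hne
    exact absurd huv
      ((BlockLT_of_blockMin_lt hsF hu hv hne huv.le).blockMin_lt (hsF.1 u hu) (hsF.1 v hv)).ne
  · obtain ⟨u, hu, hun⟩ := Finset.mem_image.1 hn.1
    exact ⟨u, hu, hun ▸ blockMin_mem (hsF.1 u hu)⟩
  · exact (hn.2 (Finset.mem_image_of_mem _ hu)).trans (blockMin_le hx)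

/-- The infinite disjoint collection of all singletons. -/
def singletons : InfColl where
  seq n := {n.succPNat}
  nonempty n := Finset.singleton_nonempty _
  lt_succ n := by
    simp only [BlockLT, Finset.mem_singleton]
    rintro _ rfl _ rfl
    exact Nat.succPNat_lt_succPNat.2 n.lt_succ_self

end BlockRamsey

/-! ### The theorem and its two examples -/

open BlockRamsey in
theorem theorem3p1 (lam : Ordinal.{0} → ℕ+ → Ordinal.{0}) (hlam : IsLadderSystem lam) :
    (∀ (F : Set (Finset (Finset ℕ+))) (D : InfColl), IsHereditary F →
      (¬ PointwiseClosed (F ∩ FinCollOf D) →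
        ∃ D₁ : InfColl, D₁.Below D ∧ FinCollOf D₁ ⊆ F) ∧
      (PointwiseClosed (F ∩ FinCollOf D) →
        (∀ D₁ : InfColl, D₁.Below D →
          ∃ ζ : Ordinal.{0}, ζ < Ordinal.omega 1 ∧ iterDeriv D₁ F ζ = ∅) ∧
        supIndex D F < Ordinal.omega 1 ∧
        ∀ ξ : Ordinal.{0}, ξ < Ordinal.omega 1 →
          (ξ + 1 < supIndex D F →
            ∃ D₂ : InfColl, D₂.Below D ∧ BlockSchreier lam ξ ∩ FinCollOf D₂ ⊆ F) ∧
          (supIndex D F < ξ + 1 →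
            ∀ D₁ : InfColl, D₁.Below D →
              (∃ D₂ : InfColl, D₂.Below D₁ ∧
                BlockSchreier lam ξ ∩ FinCollOf D₂ ⊆ FinColl \ F) ∧
              (∀ D₂ : InfColl, D₂.Below D₁ →
                (BlockSchreier lam ξ ∩ FinCollOf D₂ ⊆ FinColl \ F ↔
                  F ∩ FinCollOf D₂ ⊆
                    initialClosure (BlockSchreier lam ξ) \ BlockSchreier lam ξ))) ∧
          (ξ + 1 = supIndex D F →
            ∃ D₂ : InfColl, D₂.Below D ∧
              (BlockSchreier lam ξ ∩ FinCollOf D₂ ⊆ F ∨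
                BlockSchreier lam ξ ∩ FinCollOf D₂ ⊆ FinColl \ F)))) ∧
    (∃ (D : InfColl) (F : Set (Finset (Finset ℕ+))), IsHereditary F ∧
      PointwiseClosed (F ∩ FinCollOf D) ∧ Ordinal.omega0 + 1 = supIndex D F ∧
      ∀ D₂ : InfColl, D₂.Below D →
        BlockSchreier lam Ordinal.omega0 ∩ FinCollOf D₂ ⊆ F) ∧
    (∃ (D : InfColl) (F : Set (Finset (Finset ℕ+))), IsHereditary F ∧
      PointwiseClosed (F ∩ FinCollOf D) ∧ Ordinal.omega0 + 1 = supIndex D F ∧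
      ∀ D₂ : InfColl, D₂.Below D →
        BlockSchreier lam Ordinal.omega0 ∩ FinCollOf D₂ ⊆ FinColl \ F) := by
  refine ⟨fun F D hF => ⟨hF.isDownClosed.exists_of_not_closed, fun hclosed => ?_⟩, ?_, ?_⟩
  · have hdown := hF.isDownClosed
    obtain ⟨α, hα, hbound⟩ := hclosed.exists_countable_bound hdown hF.empty_mem
    have hα' : α + 1 < Ordinal.omega.{0} 1 := isSuccLimit_omega_one.add_one_lt hα
    have hempty : ∀ D₁ : InfColl, D₁.Below D → iterDeriv D₁ F (α + 1) = ∅ := fun D₁ hD₁ =>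
      exists_iterDeriv_eq_empty hdown (hbound D₁ hD₁)
    refine ⟨fun D₁ hD₁ => ⟨α + 1, hα', hempty D₁ hD₁⟩,
      (supIndex_le fun D₁ hD₁ => strongIndex_le (hempty D₁ hD₁)).trans_lt hα', fun ξ hξ => ?_⟩
    have hB := blockRank_blockSchreier hlam hξ
    obtain ⟨h₁, h₂, h₃⟩ := hB.trichotomy (fun s hs => hs.1) hdown hempty
    exact ⟨h₁, fun hξ D₁ hD₁ => ⟨h₂ hξ D₁ hD₁, fun D₂ _ => hB.subset_compl_iff hdown D₂⟩,
      fun _ => h₃⟩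
  -- Collections in `BlockSchreier lam ω` have cardinality equal to their least element, so all of
  -- them satisfy `≤`.
  · have hr : ∀ k k' n : ℕ, k ≤ k' → k' ≤ n → k ≤ n := fun _ _ _ => le_trans
    have hr' : ∀ k n n' : ℕ, n ≤ n' → k ≤ n → k ≤ n' := fun _ _ _ h h' => h'.trans h
    refine ⟨singletons, boundedFamily (· ≤ ·), isHereditary_boundedFamily hr,
      pointwiseClosed_boundedFamily hr (fun _ _ h => h) _,
      (supIndex_boundedFamily hr hr' (fun k => ⟨k, le_refl k⟩) (fun _ _ h => h) _).symm,
      fun D₂ _ s hs => ⟨hs.2.1, ?_⟩⟩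
    obtain ⟨n, hn, -, hmin⟩ := exists_card_of_mem_blockSchreier hs.1
    intro u hu x hx
    rw [hn]
    exact hmin u hu x hx
  -- The same equality makes the strict inequality fail at the least element.
  · have hr : ∀ k k' n : ℕ, k ≤ k' → k' < n → k < n := fun _ _ _ => lt_of_le_of_lt
    have hr' : ∀ k n n' : ℕ, n ≤ n' → k < n → k < n' := fun _ _ _ h h' => h'.trans_le h
    refine ⟨singletons, boundedFamily (· < ·), isHereditary_boundedFamily hr,
      pointwiseClosed_boundedFamily hr (fun _ _ h => h.le) _,
      (supIndex_boundedFamily hr hr' (fun k => ⟨k + 1, Nat.lt_succ_self k⟩)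
        (fun _ _ h => h.le) _).symm,
      fun D₂ _ s hs => ⟨hs.2.1, fun hsF => ?_⟩⟩
    obtain ⟨n, hn, ⟨u, hu, hnu⟩, -⟩ := exists_card_of_mem_blockSchreier hs.1
    exact (hsF.2 u hu n hnu).ne hn
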